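/- Let $R$ be an Artin algebra, that is, an algebra over a commutative Artinian ring $A$ which is finitely generated as an $A$-module. For a left or right module $M$ let $0\to M\to E^0(M)\to E^1(M)\to\cdots$ be its minimal injective coresolution, and for integers $n,k\ge 0$ call $M$ a $G_n(k)$-module if the flat dimension of $E^i(M)$ is at most $k+i$ for all $0\le i\le n-1$. Let $n,k\ge 0$ and assume that both the left module ${}_RR$ and the right module $R_R$ are $G_n(k)$-modules. Then for every left $R$-module $M$ (not necessarily finitely generated) there are left $R$-modules $I_j(M),G_j(M),I^j(M),G^j(M)$, each depending only on $j$ and $M$, such that for every $1\le i\le n-1$ there are commutative diagrams with exact rows $$\begin{array}{ccccccccc}0&\to&M&\to&I_{i+1}(M)&\to&G_{i+1}(M)&\to&0\\&&\|&&\downarrow&&\downarrow&&\\0&\to&M&\to&I_i(M)&\to&G_i(M)&\to&0\end{array}$$ and $$\begin{array}{ccccccccc}0&\to&I^{i+1}(M)&\to&G^{i+1}(M)&\to&M&\to&0\\&&\downarrow&&\downarrow&&\|&&\\0&\to&I^i(M)&\to&G^i(M)&\to&M&\to&0\end{array}$$ (the row with a given index $j$ being the same in all diagrams of its kind in which it occurs),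 in which all vertical maps are surjective, and such that for $j=i,i+1$ the modules $G_j(M)$ and $G^j(M)$ are $G_j(k)$-modules and the modules $I_j(M)$ and $I^j(M)$ have injective dimension at most $j+k$. -/

import Mathlib

universe u

open scoped TensorProduct

namespace AuslanderType

/-! Left modules over a ring `R` are `Module R`; right `R`-modules are modules over `Rᵐᵒᵖ`. -/

section Flat

variable (R : Type u) [Ring R]

/-- For a right `R`-module `N` and a left `R`-module `M`, the subgroup of `N ⊗[ℤ] M` generated by
all `(n r) ⊗ m - n ⊗ (r m)`. -/
def balancedRel (N M : Type u) [AddCommGroup N] [Module Rᵐᵒᵖ N] [AddCommGroup M] [Module R M] :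
    AddSubgroup (N ⊗[ℤ] M) :=
  AddSubgroup.closure
    {x | ∃ (n : N) (r : R) (m : M), x = (MulOpposite.op r • n) ⊗ₜ[ℤ] m - n ⊗ₜ[ℤ] (r • m)}

/-- The tensor product `N ⊗_R M` of a right module and a left module over a not necessarily
commutative ring, as an abelian group. -/
abbrev BalancedTensor (N M : Type u) [AddCommGroup N] [Module Rᵐᵒᵖ N]
    [AddCommGroup M] [Module R M] : Type u :=
  (N ⊗[ℤ] M) ⧸ balancedRel R N M

variable {N N' : Type u} [AddCommGroup N] [Module Rᵐᵒᵖ N] [AddCommGroup N'] [Module Rᵐᵒᵖ N']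

/-- The map `f ⊗_ℤ M : N ⊗[ℤ] M → N' ⊗[ℤ] M` on the tensor products of abelian groups. -/
def intTensorMap (M : Type u) [AddCommGroup M] (f : N →ₗ[Rᵐᵒᵖ] N') : N ⊗[ℤ] M →+ N' ⊗[ℤ] M :=
  (f.toAddMonoidHom.toIntLinearMap.rTensor M).toAddMonoidHom

theorem intTensorMap_tmul (M : Type u) [AddCommGroup M] (f : N →ₗ[Rᵐᵒᵖ] N') (n : N) (m : M) :
    intTensorMap R M f (n ⊗ₜ[ℤ] m) = f n ⊗ₜ[ℤ] m :=
  rfl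

theorem balancedRel_le_comap (M : Type u) [AddCommGroup M] [Module R M] (f : N →ₗ[Rᵐᵒᵖ] N') :
    balancedRel R N M ≤ (balancedRel R N' M).comap (intTensorMap R M f) := by
  refine (AddSubgroup.closure_le _).2 ?_
  rintro _ ⟨n, r, m, rfl⟩
  refine AddSubgroup.subset_closure ⟨f n, r, m, ?_⟩
  rw [map_sub, intTensorMap_tmul, intTensorMap_tmul, map_smul]

/-- The map `f ⊗_R M : N ⊗_R M → N' ⊗_R M` induced by a homomorphism `f` of right modules. -/
def BalancedTensor.map (M : Type u) [AddCommGroup M] [Module R M] (f : N →ₗ[Rᵐᵒᵖ] N') :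
    BalancedTensor R N M →+ BalancedTensor R N' M :=
  QuotientAddGroup.map _ _ (intTensorMap R M f) (balancedRel_le_comap R M f)

/-- A left `R`-module `M` is flat if `- ⊗_R M` preserves injections of right `R`-modules. -/
def IsFlat (M : Type u) [AddCommGroup M] [Module R M] : Prop :=
  ∀ (N N' : Type u) [AddCommGroup N] [Module Rᵐᵒᵖ N] [AddCommGroup N'] [Module Rᵐᵒᵖ N']
    (f : N →ₗ[Rᵐᵒᵖ] N'), Function.Injective f → Function.Injective (BalancedTensor.map R M f)

/-- The flat dimension of `M` is at most `n`: there is an exact sequence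
`0 → F_n → ⋯ → F_1 → F_0 → M → 0` with all `F_i` flat (built one syzygy at a time). -/
def FlatDimLE : ℕ → ∀ (M : Type u) [AddCommGroup M] [Module R M], Prop
  | 0, M, _, _ => IsFlat R M
  | n + 1, M, _, _ => ∃ (F : ModuleCat.{u} R) (p : F →ₗ[R] M),
      IsFlat R F ∧ Function.Surjective p ∧ FlatDimLE n (LinearMap.ker p)

end Flat

section Injective

variable (R : Type u) [Ring R]

/-- `f : M → E` is an injective envelope: `E` is injective, every homomorphism from `M` to an
injective module factors through `f`, and `f` is left minimal. -/
structure IsInjectiveEnvelope {M E : Type u} [AddCommGroup M] [Module R M]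
    [AddCommGroup E] [Module R E] (f : M →ₗ[R] E) : Prop where
  injective : Module.Injective R E
  factors : ∀ (E' : Type u) [AddCommGroup E'] [Module R E'], Module.Injective R E' →
    ∀ g : M →ₗ[R] E', ∃ h : E →ₗ[R] E', h ∘ₗ f = g
  left_minimal : ∀ h : E →ₗ[R] E, h ∘ₗ f = f → Function.Bijective h

/-- A minimal injective coresolution `0 → M → E 0 → E 1 → ⋯`. -/
structure MinimalInjectiveCoresolution (M : Type u) [AddCommGroup M] [Module R M] where
  E : ℕ → ModuleCat.{u} R
  ε : M →ₗ[R] E 0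
  d : ∀ i, E i →ₗ[R] E (i + 1)
  injective_ε : Function.Injective ε
  exact_zero : Function.Exact ε (d 0)
  exact_succ : ∀ i, Function.Exact (d i) (d (i + 1))
  envelope_zero : IsInjectiveEnvelope R ε
  envelope_succ : ∀ i, IsInjectiveEnvelope R (LinearMap.range (d i)).subtype

/-- `M` is `G_n(k)`: the `i`-th term of a minimal injective coresolution of `M` has flat dimension
at most `k + i`, for `0 ≤ i ≤ n - 1`. -/
def IsG (n k : ℕ) (M : Type u) [AddCommGroup M] [Module R M] : Prop :=
  ∃ C : MinimalInjectiveCoresolution R M, ∀ i, i < n → FlatDimLE R (k + i) (C.E i)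

end Injective

/-- `0 → X → Y → Z → 0` is exact. -/
def IsShortExact {R : Type u} [Ring R] {X Y Z : Type u} [AddCommGroup X] [Module R X]
    [AddCommGroup Y] [Module R Y] [AddCommGroup Z] [Module R Z]
    (f : X →ₗ[R] Y) (g : Y →ₗ[R] Z) : Prop :=
  Function.Injective f ∧ Function.Exact f g ∧ Function.Surjective g

end AuslanderType

/-! The hypothesis on the right module `R` produces modules of small injective dimension, and the
one on the left module `R` makes syzygies satisfy `G_j(k)`; a pullback construction combines them.

Right side: for a left module `C`, embed its additive group in a divisible group `Q` and apply
`Hom_ℤ(-, Q)` to a minimal injective coresolution of the right module `R`. This gives an exact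
sequence `⋯ → P 1 → P 0 → Z 0 → 0` of left modules, where `Z 0 = Hom_ℤ(R, Q)` is injective and
contains `C`. Duals of injective right modules are projective here (`projective_coDual`), and
dualizing turns flat dimension into injective dimension (`FlatDimLE.idLE_coDual`). So `P j` is
projective of injective dimension at most `k + j` for `j < n`, and the syzygies `Z j` inherit the
bound for `j ≤ n`.

Left side: over a semiprimary ring flat modules are projective, and the `G_n(k)` condition can be
tested on any injective coresolution. It passes from `R` to all projectives, and it follows that
every `j`-th syzygy is a `G_j(k)`-module when `j ≤ n` (`IsSyzygy.hasG`).

Tower: let `G_i → M` be surjective with `G_i` an `i`-th syzygy of some `C`. The embedding of `C` in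
`Z 0` induces `G_i → Z i`, and `G_{i+1}` is its pullback along `P i → Z i`. This is an `(i+1)`-st
syzygy of `Z 0 / C` (`IsSyzygy.exists_pullback`), and the kernel of `G_{i+1} → G_i` is `Z (i+1)`.
Starting at `G_0 = M`, the kernels of `G_j → M` are iterated extensions of modules of bounded
injective dimension. This is the second diagram; the first is the tower over `E / M`, for `E`
injective containing `M`, pulled back along `E → E / M`. -/

namespace AuslanderType

open CategoryTheory

/-! ### Tensor products over a noncommutative ring. -/

section BalancedTensor

variable {R : Type u} [Ring R] {N M : Type u} [AddCommGroup N] [Module Rᵐᵒᵖ N]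
  [AddCommGroup M] [Module R M]

/-- The class of a pure tensor in `N ⊗_R M`. -/
def BalancedTensor.tmul (R : Type u) [Ring R] {N M : Type u} [AddCommGroup N] [Module Rᵐᵒᵖ N]
    [AddCommGroup M] [Module R M] (n : N) (m : M) : BalancedTensor R N M :=
  QuotientAddGroup.mk (n ⊗ₜ[ℤ] m)

theorem BalancedTensor.smul_tmul (n : N) (r : R) (m : M) :
    tmul R (MulOpposite.op r • n) m = tmul R n (r • m) := by
  refine (QuotientAddGroup.eq_iff_sub_mem).2 ?_
  exact AddSubgroup.subset_closure ⟨n, r, m, rfl⟩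

theorem BalancedTensor.add_tmul (n n' : N) (m : M) :
    tmul R (n + n') m = tmul R n m + tmul R n' m := by
  simp only [tmul, TensorProduct.add_tmul, QuotientAddGroup.mk_add]

theorem BalancedTensor.tmul_add (n : N) (m m' : M) :
    tmul R n (m + m') = tmul R n m + tmul R n m' := by
  simp only [tmul, TensorProduct.tmul_add, QuotientAddGroup.mk_add]

theorem BalancedTensor.tmul_zero (n : N) : tmul R n (0 : M) = 0 := by
  simp only [tmul, TensorProduct.tmul_zero, QuotientAddGroup.mk_zero]

@[elab_as_elim]
theorem BalancedTensor.induction {motive : BalancedTensor R N M → Prop}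
    (x : BalancedTensor R N M) (zero : motive 0) (tmul : ∀ n m, motive (tmul R n m))
    (add : ∀ x y, motive x → motive y → motive (x + y)) : motive x := by
  induction x using QuotientAddGroup.induction_on with
  | H x =>
    induction x using TensorProduct.induction_on with
    | zero => exact zero
    | tmul n m => exact tmul n m
    | add x y hx hy => exact add _ _ hx hy

theorem BalancedTensor.addHom_ext {Q : Type*} [AddCommGroup Q] {f g : BalancedTensor R N M →+ Q}
    (h : ∀ n m, f (tmul R n m) = g (tmul R n m)) : f = g := by
  ext x
  change f (QuotientAddGroup.mk x) = g (QuotientAddGroup.mk x)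
  generalize (QuotientAddGroup.mk x : BalancedTensor R N M) = y
  induction y using BalancedTensor.induction with
  | zero => simp
  | tmul n m => exact h n m
  | add x y hx hy => rw [map_add, map_add, hx, hy]

/-- A balanced biadditive map induces an additive map on `N ⊗_R M`. -/
def BalancedTensor.lift {Q : Type*} [AddCommGroup Q] (B : N →+ M →+ Q)
    (hB : ∀ (n : N) (r : R) (m : M), B (MulOpposite.op r • n) m = B n (r • m)) :
    BalancedTensor R N M →+ Q :=
  QuotientAddGroup.lift _
    (TensorProduct.liftAddHom B fun z n m => by simp) (by
      refine (AddSubgroup.closure_le _).2 ?_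
      rintro _ ⟨n, r, m, rfl⟩
      simp [hB])

@[simp]
theorem BalancedTensor.map_tmul {N' : Type u} [AddCommGroup N'] [Module Rᵐᵒᵖ N']
    (f : N →ₗ[Rᵐᵒᵖ] N') (n : N) (m : M) : map R M f (tmul R n m) = tmul R (f n) m :=
  rfl

end BalancedTensor

/-- Homomorphisms into an injective module extend along a map whose kernel they annihilate. -/
theorem exists_comp_eq_of_ker_le {S : Type*} [Ring S] {X Y E : Type*} [AddCommGroup X] [Module S X]
    [AddCommGroup Y] [Module S Y] [AddCommGroup E] [Module S E] (hE : Module.Baer S E)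
    (g : X →ₗ[S] Y) (ν : X →ₗ[S] E) (h : LinearMap.ker g ≤ LinearMap.ker ν) :
    ∃ μ : Y →ₗ[S] E, μ ∘ₗ g = ν := by
  obtain ⟨μ, hμ⟩ := hE.extension_property ((LinearMap.ker g).liftQ g le_rfl)
    (LinearMap.ker_eq_bot.1 (Submodule.ker_liftQ_eq_bot _ _ _ le_rfl))
    ((LinearMap.ker g).liftQ ν h)
  refine ⟨μ, LinearMap.ext fun x => ?_⟩
  exact DFunLike.congr_fun hμ (Submodule.Quotient.mk x)

/-! ### Duals `Hom_ℤ(N, Q)` of right modules; flatness and injectivity. -/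

section Dual

universe v w

/-- The additive maps from a right `R`-module `N` to an abelian group `Q`, as a left `R`-module. -/
def CoDual (N : Type v) (Q : Type w) [AddCommGroup N] [AddCommGroup Q] : Type (max v w) := N →+ Q

namespace CoDual

variable {N : Type v} {Q : Type w} [AddCommGroup N] [AddCommGroup Q]

instance : AddCommGroup (CoDual N Q) := inferInstanceAs (AddCommGroup (N →+ Q))

instance : FunLike (CoDual N Q) N Q := inferInstanceAs (FunLike (N →+ Q) N Q)

instance : AddMonoidHomClass (CoDual N Q) N Q := inferInstanceAs (AddMonoidHomClass (N →+ Q) N Q)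

@[ext] theorem ext {φ ψ : CoDual N Q} (h : ∀ n, φ n = ψ n) : φ = ψ := DFunLike.ext _ _ h

@[simp] theorem add_apply (φ ψ : CoDual N Q) (n : N) : (φ + ψ) n = φ n + ψ n := rfl

@[simp] theorem zero_apply (n : N) : (0 : CoDual N Q) n = 0 := rfl

theorem sum_apply {ι : Type*} (s : Finset ι) (φ : ι → CoDual N Q) (n : N) :
    (∑ i ∈ s, φ i) n = ∑ i ∈ s, φ i n :=
  map_sum (AddMonoidHom.mk' (fun φ : CoDual N Q => φ n) fun _ _ => rfl) _ _

variable {R : Type*} [Ring R] [Module Rᵐᵒᵖ N]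

instance : Module R (CoDual N Q) where
  smul r φ := AddMonoidHom.comp (φ : N →+ Q) (DistribSMul.toAddMonoidHom N (MulOpposite.op r))
  one_smul φ := ext fun n => congrArg φ (one_smul Rᵐᵒᵖ n)
  mul_smul r s φ := ext fun n => congrArg φ (mul_smul (MulOpposite.op s) (MulOpposite.op r) n)
  smul_zero _ := rfl
  smul_add _ _ _ := rfl
  add_smul r s φ := ext fun n =>
    (congrArg φ (add_smul (MulOpposite.op r) (MulOpposite.op s) n)).trans (map_add φ _ _)
  zero_smul φ := ext fun n => (congrArg φ (zero_smul Rᵐᵒᵖ n)).trans (map_zero φ)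

@[simp] theorem smul_apply (r : R) (φ : CoDual N Q) (n : N) :
    (r • φ) n = φ (MulOpposite.op r • n) := rfl

variable {N' : Type v} [AddCommGroup N'] [Module Rᵐᵒᵖ N']

/-- Precomposition with a homomorphism of right modules. -/
def map (Q : Type w) [AddCommGroup Q] (f : N →ₗ[Rᵐᵒᵖ] N') : CoDual N' Q →ₗ[R] CoDual N Q where
  toFun φ := AddMonoidHom.comp (φ : N' →+ Q) f.toAddMonoidHom
  map_add' _ _ := rfl
  map_smul' r φ := ext fun n => congrArg φ (f.map_smul (MulOpposite.op r) n).symm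

@[simp] theorem map_apply (f : N →ₗ[Rᵐᵒᵖ] N') (φ : CoDual N' Q) (n : N) :
    map Q f φ n = φ (f n) := rfl

theorem map_surjective (hQ : Module.Baer ℤ Q) {f : N →ₗ[Rᵐᵒᵖ] N'} (hf : Function.Injective f) :
    Function.Surjective (map Q f) := fun φ => by
  obtain ⟨ψ, hψ⟩ := hQ.extension_property_addMonoidHom f.toAddMonoidHom hf φ
  exact ⟨ψ, hψ⟩

theorem map_injective {f : N →ₗ[Rᵐᵒᵖ] N'} (hf : Function.Surjective f) :
    Function.Injective (map Q f) := fun φ ψ h => ext fun n => by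
  obtain ⟨n, rfl⟩ := hf n
  exact DFunLike.congr_fun h n

theorem map_exact {N'' : Type v} [AddCommGroup N''] [Module Rᵐᵒᵖ N''] {f : N →ₗ[Rᵐᵒᵖ] N'}
    {g : N' →ₗ[Rᵐᵒᵖ] N''} (hfg : Function.Exact f g) (hQ : Module.Baer ℤ Q) :
    Function.Exact (map Q g) (map Q f) := fun φ => by
  constructor
  · intro h
    obtain ⟨ψ, hψ⟩ := exists_comp_eq_of_ker_le hQ g.toAddMonoidHom.toIntLinearMap
      (AddMonoidHom.toIntLinearMap (φ : N' →+ Q)) fun x hx => by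
        obtain ⟨n, rfl⟩ := (hfg x).1 hx
        exact DFunLike.congr_fun h n
    exact ⟨ψ.toAddMonoidHom, ext fun n => DFunLike.congr_fun hψ n⟩
  · rintro ⟨ψ, rfl⟩
    ext n
    exact (congrArg ψ (hfg.apply_apply_eq_zero n)).trans (map_zero ψ)

end CoDual

/-- The dual of a flat right module is an injective left module. -/
theorem IsFlat.injective_coDual {R : Type u} [Ring R] {N Q : Type u} [AddCommGroup N]
    [Module Rᵐᵒᵖ N] [AddCommGroup Q] (hQ : Module.Baer ℤ Q) (hN : IsFlat Rᵐᵒᵖ N) :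
    Module.Injective R (CoDual N Q) where
  out X Y _ _ _ _ f hf g := by
    -- Flatness over `Rᵐᵒᵖ` is tested on `Rᵐᵒᵖᵐᵒᵖ`-modules, so `X` and `Y` are transported along `R
    -- ≃ Rᵐᵒᵖᵐᵒᵖ`.
    let : Module Rᵐᵒᵖᵐᵒᵖ X := Module.compHom X (RingEquiv.opOp R).symm.toRingHom
    let : Module Rᵐᵒᵖᵐᵒᵖ Y := Module.compHom Y (RingEquiv.opOp R).symm.toRingHom
    let f' : X →ₗ[Rᵐᵒᵖᵐᵒᵖ] Y :=
      { toFun := f, map_add' := f.map_add, map_smul' := fun r x => f.map_smul _ x }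
    let B : X →+ N →+ Q := AddMonoidHom.mk' (fun x => (g x : N →+ Q)) fun x y => g.map_add x y
    have hB : ∀ (x : X) (r : Rᵐᵒᵖ) (n : N), B (MulOpposite.op r • x) n = B x (r • n) := by
      intro x r n
      exact DFunLike.congr_fun (g.map_smul (MulOpposite.unop r) x) n
    -- By adjunction `g` is an additive map on the tensor product of `X` and `N`. Flatness embeds
    -- this group in the one for `Y`, and divisibility of `Q` extends the map.
    obtain ⟨χ, hχ⟩ := hQ.extension_property_addMonoidHom (BalancedTensor.map Rᵐᵒᵖ N f')
      (hN X Y f' hf) (BalancedTensor.lift B hB)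
    let h : Y →ₗ[R] CoDual N Q :=
      { toFun := fun y => AddMonoidHom.mk' (fun n => χ (BalancedTensor.tmul Rᵐᵒᵖ y n)) fun n n' => by
          rw [BalancedTensor.tmul_add, map_add]
        map_add' := fun y y' => CoDual.ext fun n => by
          change χ (BalancedTensor.tmul Rᵐᵒᵖ (y + y') n) = _
          rw [BalancedTensor.add_tmul, map_add]; rfl
        map_smul' := fun r y => CoDual.ext fun n => by
          change χ (BalancedTensor.tmul Rᵐᵒᵖ (MulOpposite.op (MulOpposite.op r) • y) n) = _
          rw [BalancedTensor.smul_tmul]; rfl }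
    exact ⟨h, fun x => CoDual.ext fun n =>
      DFunLike.congr_fun hχ (BalancedTensor.tmul Rᵐᵒᵖ x n)⟩

/-- A projective module is flat. -/
theorem isFlat_of_projective {R : Type u} [Ring R] (M : Type u) [AddCommGroup M] [Module R M]
    [Module.Projective R M] : IsFlat R M := by
  intro N N' _ _ _ _ f hf
  rw [injective_iff_map_eq_zero]
  intro x hx
  by_contra hne
  -- By adjunction a character with `χ x ≠ 0` is a map `M → Hom(N, ℚ/ℤ)`. Projectivity lifts it to
  -- `Hom(N', ℚ/ℤ)`, so `χ` factors through the tensor map, which kills `x`.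
  obtain ⟨χ, hχ⟩ := CharacterModule.exists_character_apply_ne_zero_of_ne_zero hne
  have hQ : Module.Baer ℤ (AddCircle (1 : ℚ)) := Module.Baer.of_divisible _
  let h : M →ₗ[R] CoDual N (AddCircle (1 : ℚ)) :=
    { toFun := fun m => AddMonoidHom.mk' (fun n => χ (BalancedTensor.tmul R n m)) fun n n' => by
        rw [BalancedTensor.add_tmul, map_add]
      map_add' := fun m m' => CoDual.ext fun n => by
        change χ (BalancedTensor.tmul R n (m + m')) = _
        rw [BalancedTensor.tmul_add, map_add]; rfl
      map_smul' := fun r m => CoDual.ext fun n => by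
        change χ (BalancedTensor.tmul R n (r • m)) = _
        rw [← BalancedTensor.smul_tmul]; rfl }
  obtain ⟨h', hh'⟩ := Module.projective_lifting_property
    (CoDual.map (R := R) (AddCircle (1 : ℚ)) f) h (CoDual.map_surjective hQ hf)
  let B : N' →+ M →+ AddCircle (1 : ℚ) :=
    AddMonoidHom.flip (AddMonoidHom.mk' (fun m => (h' m : N' →+ AddCircle (1 : ℚ))) h'.map_add)
  have hB : ∀ (n : N') (r : R) (m : M), B (MulOpposite.op r • n) m = B n (r • m) := fun n r m =>
    (DFunLike.congr_fun (h'.map_smul r m) n).symm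
  have key : (BalancedTensor.lift B hB).comp (BalancedTensor.map R M f) =
      (χ : BalancedTensor R N M →+ AddCircle (1 : ℚ)) :=
    BalancedTensor.addHom_ext fun n m => DFunLike.congr_fun (DFunLike.congr_fun hh' m) n
  apply hχ
  have h1 := DFunLike.congr_fun key x
  rw [AddMonoidHom.comp_apply, hx, map_zero] at h1
  exact h1.symm

end Dual

/-! ### Projective, injective and flat dimension in short exact sequences. -/

section Dimension

variable {R : Type u} [Ring R]

/-- `M` has projective dimension at most `d`. -/
abbrev PdLE (R : Type u) [Ring R] (d : ℕ) (M : Type u) [AddCommGroup M] [Module R M] : Prop :=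
  HasProjectiveDimensionLE (ModuleCat.of R M) d

/-- `M` has injective dimension at most `d`. -/
abbrev IdLE (R : Type u) [Ring R] (d : ℕ) (M : Type u) [AddCommGroup M] [Module R M] : Prop :=
  HasInjectiveDimensionLE (ModuleCat.of R M) d

variable {X Y Z : Type u} [AddCommGroup X] [Module R X] [AddCommGroup Y] [Module R Y]
  [AddCommGroup Z] [Module R Z]

/-- A short exact sequence of modules as a short complex. -/
abbrev IsShortExact.toShortComplex {f : X →ₗ[R] Y} {g : Y →ₗ[R] Z} (h : IsShortExact f g) :
    ShortComplex (ModuleCat.{u} R) :=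
  ModuleCat.shortComplexOfCompEqZero f g h.2.1.linearMap_comp_eq_zero

theorem IsShortExact.shortExact {f : X →ₗ[R] Y} {g : Y →ₗ[R] Z} (h : IsShortExact f g) :
    h.toShortComplex.ShortExact :=
  ModuleCat.shortComplex_shortExact _ h.2.1 h.1 h.2.2

theorem isShortExact_ker {g : Y →ₗ[R] Z} (hg : Function.Surjective g) :
    IsShortExact (LinearMap.ker g).subtype g :=
  ⟨Subtype.val_injective, LinearMap.exact_subtype_ker_map g, hg⟩

theorem isShortExact_mkQ {f : X →ₗ[R] Y} (hf : Function.Injective f) :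
    IsShortExact f (LinearMap.range f).mkQ :=
  ⟨hf, LinearMap.exact_map_mkQ_range f, Submodule.mkQ_surjective _⟩

theorem pdLE_zero_iff : PdLE R 0 X ↔ Module.Projective R X := by
  rw [PdLE, ← projective_iff_hasProjectiveDimensionLE_zero, ← IsProjective.iff_projective]

theorem idLE_zero_iff : IdLE R 0 X ↔ Module.Injective R X := by
  rw [IdLE, HasInjectiveDimensionLE, zero_add, ← injective_iff_hasInjectiveDimensionLT_one,
    ← Module.injective_iff_injective_object]

theorem PdLE.mono {d e : ℕ} (h : PdLE R d X) (hde : d ≤ e) : PdLE R e X :=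
  hasProjectiveDimensionLT_of_ge _ (d + 1) _ (by lia)

theorem IdLE.mono {d e : ℕ} (h : IdLE R d X) (hde : d ≤ e) : IdLE R e X :=
  hasInjectiveDimensionLT_of_ge _ (d + 1) _ (by lia)

theorem IsShortExact.idLE_middle {f : X →ₗ[R] Y} {g : Y →ₗ[R] Z} (h : IsShortExact f g) {d : ℕ}
    (hX : IdLE R d X) (hZ : IdLE R d Z) : IdLE R d Y :=
  h.shortExact.hasInjectiveDimensionLT_X₂ _ hX hZ

theorem IsShortExact.idLE_left {f : X →ₗ[R] Y} {g : Y →ₗ[R] Z} (h : IsShortExact f g) {d : ℕ}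
    (hY : IdLE R (d + 1) Y) (hZ : IdLE R d Z) : IdLE R (d + 1) X :=
  h.shortExact.hasInjectiveDimensionLT_X₁ _ hZ hY

theorem IsShortExact.pdLE_middle {f : X →ₗ[R] Y} {g : Y →ₗ[R] Z} (h : IsShortExact f g) {d : ℕ}
    (hX : PdLE R d X) (hZ : PdLE R d Z) : PdLE R d Y :=
  h.shortExact.hasProjectiveDimensionLT_X₂ _ hX hZ

theorem IsShortExact.pdLE_right {f : X →ₗ[R] Y} {g : Y →ₗ[R] Z} (h : IsShortExact f g) {d : ℕ}
    (hX : PdLE R d X) (hY : PdLE R (d + 1) Y) : PdLE R (d + 1) Z :=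
  h.shortExact.hasProjectiveDimensionLT_X₃ _ hX hY

theorem IsShortExact.pdLE_left {f : X →ₗ[R] Y} {g : Y →ₗ[R] Z} (h : IsShortExact f g) {d : ℕ}
    (hY : PdLE R d Y) (hZ : PdLE R (d + 1) Z) : PdLE R d X :=
  h.shortExact.hasProjectiveDimensionLT_X₁ _ hY hZ

theorem PdLE.of_retract {d : ℕ} (h : PdLE R d Y) (i : X →ₗ[R] Y) (r : Y →ₗ[R] X)
    (hri : r ∘ₗ i = LinearMap.id) : PdLE R d X :=
  Retract.hasProjectiveDimensionLT (X := ModuleCat.of R X) (Y := ModuleCat.of R Y)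
    ⟨ModuleCat.ofHom i, ModuleCat.ofHom r, by rw [← ModuleCat.ofHom_comp, hri]; rfl⟩ _

theorem PdLE.prod {d : ℕ} (hX : PdLE R d X) (hY : PdLE R d Y) : PdLE R d (X × Y) :=
  IsShortExact.pdLE_middle (f := LinearMap.inl R X Y) (g := LinearMap.snd R X Y)
    ⟨LinearMap.inl_injective, Function.Exact.inl_snd, LinearMap.snd_surjective⟩ hX hY

/-- If the flat dimension of the right module `N` is at most `d`, then the injective dimension of
its dual is at most `d`. -/
theorem FlatDimLE.idLE_coDual {Q : Type u} [AddCommGroup Q] (hQ : Module.Baer ℤ Q) {d : ℕ}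
    {N : Type u} [AddCommGroup N] [Module Rᵐᵒᵖ N] (h : FlatDimLE Rᵐᵒᵖ d N) :
    IdLE R d (CoDual N Q) := by
  induction d generalizing N with
  | zero => exact idLE_zero_iff.2 (IsFlat.injective_coDual hQ h)
  | succ d ih =>
    obtain ⟨F, p, hF, hp, hK⟩ := h
    have hs := isShortExact_ker hp
    have : IsShortExact (CoDual.map (R := R) Q p)
        (CoDual.map (R := R) Q (LinearMap.ker p).subtype) :=
      ⟨CoDual.map_injective hp, CoDual.map_exact hs.2.1 hQ, CoDual.map_surjective hQ hs.1⟩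
    exact this.idLE_left ((idLE_zero_iff.2 (IsFlat.injective_coDual hQ hF)).mono (by lia)) (ih hK)

theorem FlatDimLE.of_pdLE {d : ℕ} {M : Type u} [AddCommGroup M] [Module R M] (h : PdLE R d M) :
    FlatDimLE R d M := by
  induction d generalizing M with
  | zero =>
    have := pdLE_zero_iff.1 h
    exact isFlat_of_projective M
  | succ d ih =>
    have hs := isShortExact_ker (Finsupp.linearCombination_id_surjective R M)
    refine ⟨ModuleCat.of R (M →₀ R), Finsupp.linearCombination R id, isFlat_of_projective _,
      hs.2.2, ih (hs.pdLE_left ?_ h)⟩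
    exact (pdLE_zero_iff.2 inferInstance).mono (Nat.zero_le _)

end Dimension

/-! ### Projectivity criteria over semiprimary rings. -/

section Semiprimary

variable {R : Type u} [Ring R] [IsSemiprimaryRing R]

theorem isSemisimpleModule_quotient_jacobson_smul (P : Type u) [AddCommGroup P] [Module R P] :
    IsSemisimpleModule R (P ⧸ Ring.jacobson R • (⊤ : Submodule R P)) := by
  have h : Module.IsTorsionBySet R (P ⧸ Ring.jacobson R • (⊤ : Submodule R P))
      (Ring.jacobson R) :=
    (Module.isTorsionBySet_quotient_iff _ _).2 fun m i hi => Submodule.smul_mem_smul hi trivial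
  let _ := h.module
  exact (h.semilinearMap.isSemisimpleModule_iff_of_bijective Function.bijective_id).2
    inferInstance

/-- A quotient `F` of a projective module `P` with kernel `K` over a semiprimary ring with Jacobson
radical `J` is projective as soon as `K ∩ J P = J K`. -/
theorem projective_of_ker_inf_jacobson_le {P F : Type u} [AddCommGroup P] [Module R P]
    [AddCommGroup F] [Module R F] [Module.Projective R P] {p : P →ₗ[R] F}
    (hp : Function.Surjective p)
    (h : LinearMap.ker p ⊓ Ring.jacobson R • ⊤ ≤ Ring.jacobson R • LinearMap.ker p) :
    Module.Projective R F := by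
  -- Extending the identity of the kernel `K` to `P` splits `K` off; the general target `N` allows
  -- induction along the radical filtration.
  have ext : ∀ (N : Type u) [AddCommGroup N] [Module R N] (g : LinearMap.ker p →ₗ[R] N),
      ∃ h : P →ₗ[R] N, h ∘ₗ (LinearMap.ker p).subtype = g := by
    intro N _ _
    refine IsSemiprimaryRing.induction ℤ R N
      (P := fun N _ _ _ => ∀ g : LinearMap.ker p →ₗ[R] N,
        ∃ h : P →ₗ[R] N, h ∘ₗ (LinearMap.ker p).subtype = g) ?_ ?_
    · intro N _ _ _ _ _ hN g
      have hss := isSemisimpleModule_quotient_jacobson_smul (R := R) P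
      let q : LinearMap.ker p →ₗ[R] P ⧸ Ring.jacobson R • (⊤ : Submodule R P) :=
        Submodule.mkQ _ ∘ₗ (LinearMap.ker p).subtype
      -- Here `J N = 0`, so `g` kills `J K`, which contains the kernel of `K → P / J P` by
      -- hypothesis. Since `P / J P` is semisimple, the image of `K` is a summand and `g` extends.
      have hq : LinearMap.ker q ≤ LinearMap.ker g := by
        intro x hx
        have hx' : (x : P) ∈ Ring.jacobson R • LinearMap.ker p :=
          h ⟨x.2, (Submodule.Quotient.mk_eq_zero _).1 hx⟩
        have hle : Ring.jacobson R • LinearMap.ker p ≤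
            (LinearMap.ker g).map (LinearMap.ker p).subtype := by
          rw [Submodule.smul_le]
          intro r hr n hn
          refine ⟨r • ⟨n, hn⟩, ?_, rfl⟩
          change g (r • _) = 0
          rw [map_smul]
          exact hN (a := ⟨r, hr⟩)
        obtain ⟨y, hy, hyx⟩ := hle hx'
        rwa [← Subtype.ext hyx]
      obtain ⟨C, hC⟩ := exists_isCompl (LinearMap.range q)
      refine ⟨((LinearMap.ker q).liftQ g hq) ∘ₗ (q.quotKerEquivRange.symm : _ →ₗ[R] _) ∘ₗ
        Submodule.projectionOnto _ _ hC ∘ₗ Submodule.mkQ _, LinearMap.ext fun x => ?_⟩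
      have hx : Submodule.projectionOnto _ _ hC (q x) = ⟨q x, LinearMap.mem_range_self q x⟩ :=
        Submodule.projectionOnto_apply_left hC ⟨q x, LinearMap.mem_range_self q x⟩
      change (LinearMap.ker q).liftQ g hq (q.quotKerEquivRange.symm
        (Submodule.projectionOnto _ _ hC (q x))) = g x
      rw [hx, LinearMap.quotKerEquivRange_symm_apply_image q x]
      rfl
    · intro N _ _ _ _ S hS hQ g
      -- Extend modulo `S`, lift the extension to `N` by projectivity of `P`, and correct the error,
      -- which takes values in `S`.
      obtain ⟨h₁, hh₁⟩ := hQ (S.mkQ ∘ₗ g)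
      obtain ⟨h₂, hh₂⟩ := Module.projective_lifting_property S.mkQ h₁ S.mkQ_surjective
      have hmem : ∀ x, (g - h₂ ∘ₗ (LinearMap.ker p).subtype) x ∈ S := fun x => by
        rw [← S.ker_mkQ, LinearMap.mem_ker, LinearMap.sub_apply, map_sub, sub_eq_zero]
        exact (DFunLike.congr_fun hh₁ x).symm.trans (DFunLike.congr_fun hh₂ (x : P)).symm
      obtain ⟨h₃, hh₃⟩ := hS (LinearMap.codRestrict S _ hmem)
      refine ⟨h₂ + S.subtype ∘ₗ h₃, LinearMap.ext fun x => ?_⟩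
      have := congrArg Subtype.val (DFunLike.congr_fun hh₃ x)
      simp only [LinearMap.comp_apply, LinearMap.codRestrict_apply, LinearMap.sub_apply] at this
      simp [LinearMap.comp_apply] at this ⊢
      rw [this]; abel
  obtain ⟨r, hr⟩ := ext _ LinearMap.id
  let e : F →ₗ[R] P := ((LinearMap.ker p).liftQ (LinearMap.id - (LinearMap.ker p).subtype ∘ₗ r)
    fun x hx => by
      have := congrArg Subtype.val (DFunLike.congr_fun hr ⟨x, hx⟩)
      simp only [LinearMap.comp_apply, Submodule.subtype_apply, LinearMap.id_apply] at this
      simp [this]) ∘ₗ ((p.quotKerEquivOfSurjective hp).symm : F →ₗ[R] _)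
  refine Module.Projective.of_split e p (LinearMap.ext fun f => ?_)
  obtain ⟨x, rfl⟩ := hp f
  have hx : (p.quotKerEquivOfSurjective hp).symm (p x) = Submodule.Quotient.mk x := by
    rw [LinearEquiv.symm_apply_eq]; rfl
  simp [e, hx]

/-- A flat module over a semiprimary ring is projective. -/
theorem IsFlat.projective {F : Type u} [AddCommGroup F] [Module R F] (hF : IsFlat R F) :
    Module.Projective R F := by
  let p : (F →₀ R) →ₗ[R] F := Finsupp.linearCombination R id
  have hp : Function.Surjective p := Finsupp.linearCombination_id_surjective R F
  refine projective_of_ker_inf_jacobson_le hp ?_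
  -- The radical as a right module: flatness is used only for the inclusion `J → R`.
  let J : Submodule Rᵐᵒᵖ R :=
    { carrier := Ring.jacobson R
      add_mem' := add_mem
      zero_mem' := zero_mem _
      smul_mem' := fun r x hx => (Ring.jacobson R).mul_mem_right _ hx }
  set JK := Ring.jacobson R • LinearMap.ker p with hJK
  let s : F → (F →₀ R) := fun f => Finsupp.single f 1
  have hs : ∀ f, p (s f) = f := fun f => by simp [p, s]
  -- The section `s` is not linear, but two lifts of an element of `F` differ by an element of `K`,
  -- so `a • s f` is additive and balanced modulo `J K`.
  have hmk : ∀ (a : J) (x y : F →₀ R), p x = p y → JK.mkQ ((a : R) • x) = JK.mkQ ((a : R) • y) := by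
    intro a x y hxy
    rw [← sub_eq_zero, ← map_sub, ← smul_sub]
    exact (Submodule.Quotient.mk_eq_zero _).2
      (Submodule.smul_mem_smul a.2 (by rw [LinearMap.mem_ker, map_sub, hxy, sub_self]))
  let B : J →+ F →+ (F →₀ R) ⧸ JK := AddMonoidHom.mk'
    (fun a => AddMonoidHom.mk' (fun f => JK.mkQ ((a : R) • s f)) fun f f' => by
      rw [← map_add, ← smul_add]
      exact hmk a _ _ (by simp [hs]))
    fun a a' => by ext f; simp [add_smul]
  have hB : ∀ (a : J) (r : R) (f : F), B (MulOpposite.op r • a) f = B a (r • f) := by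
    intro a r f
    change JK.mkQ (((a : R) * r) • s f) = JK.mkQ ((a : R) • s (r • f))
    rw [mul_smul]
    exact hmk a _ _ (by simp [hs])
  -- An element `x` of `J P` comes from some `t` in `J ⊗ F` that recovers `x` modulo `J K` and maps
  -- to `1 ⊗ p x`. If `p x = 0`, flatness gives `t = 0`, hence `x ∈ J K`.
  have key : ∀ x ∈ Ring.jacobson R • (⊤ : Submodule R (F →₀ R)), ∃ t : BalancedTensor R J F,
      BalancedTensor.lift B hB t = JK.mkQ x ∧
      BalancedTensor.map R F J.subtype t = BalancedTensor.tmul R (1 : R) (p x) := by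
    intro x hx
    induction hx using Submodule.smul_induction_on' with
    | smul r hr n hn =>
      refine ⟨BalancedTensor.tmul R (⟨r, hr⟩ : J) (p n), hmk ⟨r, hr⟩ _ _ (hs _), ?_⟩
      rw [BalancedTensor.map_tmul, map_smul, ← BalancedTensor.smul_tmul]
      simp
    | add x hx y hy ihx ihy =>
      obtain ⟨t, ht, ht'⟩ := ihx
      obtain ⟨t', h₁, h₁'⟩ := ihy
      exact ⟨t + t', by rw [map_add, map_add, ht, h₁],
        by rw [map_add, map_add, BalancedTensor.tmul_add, ht', h₁']⟩
  rintro x ⟨hx, hx'⟩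
  obtain ⟨t, ht, ht'⟩ := key x hx'
  rw [LinearMap.mem_ker.1 hx, BalancedTensor.tmul_zero] at ht'
  have h0 : t = 0 := hF J R J.subtype Subtype.val_injective (ht'.trans (map_zero _).symm)
  rw [h0, map_zero] at ht
  exact (Submodule.Quotient.mk_eq_zero _).1 ht.symm

theorem FlatDimLE.pdLE {d : ℕ} {M : Type u} [AddCommGroup M] [Module R M] (h : FlatDimLE R d M) :
    PdLE R d M := by
  induction d generalizing M with
  | zero => exact pdLE_zero_iff.2 (IsFlat.projective h)
  | succ d ih =>
    obtain ⟨F, p, hF, hp, hK⟩ := h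
    exact (isShortExact_ker hp).pdLE_right (ih hK)
      ((pdLE_zero_iff.2 (IsFlat.projective hF)).mono (Nat.zero_le _))

theorem exists_sum_of_mem_ideal_smul {S P : Type*} [Ring S] [AddCommGroup P] [Module S P]
    {I : Ideal S} {L : Submodule S P} {x : P} (hx : x ∈ I • L) :
    ∃ (ι : Type) (_ : Fintype ι) (a : ι → S) (y : ι → P),
      (∀ i, a i ∈ I) ∧ x = ∑ i, a i • y i := by
  induction hx using Submodule.smul_induction_on' with
  | smul r hr n hn => exact ⟨Unit, inferInstance, fun _ => r, fun _ => n, fun _ => hr, by simp⟩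
  | add x hx y hy ihx ihy =>
    obtain ⟨ι, _, a, u, ha, rfl⟩ := ihx
    obtain ⟨κ, _, b, v, hb, rfl⟩ := ihy
    exact ⟨ι ⊕ κ, inferInstance, Sum.elim a b, Sum.elim u v, by rintro (i | i) <;> simp [ha, hb],
      by simp⟩

/-- Linear relations with coefficients in `R` between elements of the dual of an injective right
module are consequences of relations in `R`. -/
theorem CoDual.exists_of_sum_smul_eq_zero {R : Type u} [Ring R] [IsNoetherianRing Rᵐᵒᵖ]
    {N Q : Type u} [AddCommGroup N] [Module Rᵐᵒᵖ N]
    [AddCommGroup Q] (hQ : Module.Baer ℤ Q) (hN : Module.Injective Rᵐᵒᵖ N)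
    {ι : Type} [Fintype ι] (a : ι → R) (φ : ι → CoDual N Q) (h : ∑ i, a i • φ i = 0) :
    ∃ (l : ℕ) (z : Fin l → ι → R) (ψ : Fin l → CoDual N Q),
      (∀ s, ∑ i, a i * z s i = 0) ∧ ∀ i, φ i = ∑ s, z s i • ψ s := by
  classical
  -- The `z s` generate the right module of relations `∑ a i * r i = 0`, which is finitely generated
  -- by noetherianity.
  let θ : (ι → Rᵐᵒᵖ) →ₗ[Rᵐᵒᵖ] R := Fintype.linearCombination Rᵐᵒᵖ a
  obtain ⟨l, z, hz⟩ := Submodule.fg_iff_exists_fin_generating_family.1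
    (IsNoetherian.noetherian (LinearMap.ker θ))
  have hzθ : ∀ s, ∑ i, a i * (z s i).unop = 0 := fun s => by
    have : z s ∈ LinearMap.ker θ := hz ▸ Submodule.subset_span ⟨s, rfl⟩
    simpa [θ, Fintype.linearCombination_apply] using this
  let U : (ι → N) →ₗ[ℤ] (Fin l → N) := AddMonoidHom.toIntLinearMap <|
    AddMonoidHom.mk' (fun n s => ∑ i, z s i • n i) fun n n' => by
      ext s; simp [Finset.sum_add_distrib]
  let Φ : (ι → N) →ₗ[ℤ] Q := AddMonoidHom.toIntLinearMap <|
    AddMonoidHom.mk' (fun n => ∑ i, φ i (n i)) fun n n' => by simp [Finset.sum_add_distrib]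
  -- A family `n` killed by all relations `z s` factors through `θ` by injectivity of `N`: `n i` is
  -- `μ 1` acted on by `a i`. Then `Φ n = (∑ a i • φ i) (μ 1) = 0`.
  have hU : LinearMap.ker U ≤ LinearMap.ker Φ := by
    intro n hn
    let ν : (ι → Rᵐᵒᵖ) →ₗ[Rᵐᵒᵖ] N := Fintype.linearCombination Rᵐᵒᵖ n
    have hν : LinearMap.ker θ ≤ LinearMap.ker ν := by
      rw [← hz, Submodule.span_le]
      rintro _ ⟨s, rfl⟩
      exact congrFun hn s
    obtain ⟨μ, hμ⟩ := exists_comp_eq_of_ker_le (Module.Baer.of_injective hN) θ ν hν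
    have hni : ∀ i, n i = MulOpposite.op (a i) • μ 1 := fun i => by
      have := DFunLike.congr_fun hμ (Pi.single i 1)
      simp only [LinearMap.comp_apply, θ, ν, Fintype.linearCombination_apply_single,
        one_smul] at this
      rw [← this, ← map_smul]
      simp
    have h0 := DFunLike.congr_fun h (μ 1)
    rw [CoDual.sum_apply] at h0
    change ∑ i, φ i (n i) = 0
    simp_rw [hni]
    exact h0
  obtain ⟨Ψ, hΨ⟩ := exists_comp_eq_of_ker_le hQ U Φ hU
  refine ⟨l, fun s i => (z s i).unop,
    fun s => (Ψ.toAddMonoidHom.comp (AddMonoidHom.single (fun _ => N) s) : N →+ Q), hzθ,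
    fun i => CoDual.ext fun n => ?_⟩
  have h1 := DFunLike.congr_fun hΨ (Pi.single i n)
  have h2 : Φ (Pi.single i n) = φ i n := by
    change ∑ j, φ j ((Pi.single i n : ι → N) j) = _
    rw [Finset.sum_eq_single i (fun j _ hj => by simp [hj]) (by simp)]
    simp
  have h3 : U (Pi.single i n) = ∑ s, Pi.single s (z s i • n) := by
    ext s
    change ∑ j, z s j • (Pi.single i n : ι → N) j = _
    rw [Finset.sum_eq_single i (fun j _ hj => by simp [hj]) (by simp), Finset.sum_apply,
      Finset.sum_eq_single s (fun j _ hj => by simp [hj.symm]) (by simp)]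
    simp
  rw [← h2, ← h1, LinearMap.comp_apply, h3, map_sum, CoDual.sum_apply]
  rfl

/-- The dual of an injective right module over a ring that is right noetherian and semiprimary is
projective. -/
theorem projective_coDual [IsNoetherianRing Rᵐᵒᵖ] {N Q : Type u} [AddCommGroup N] [Module Rᵐᵒᵖ N]
    [AddCommGroup Q] (hQ : Module.Baer ℤ Q) (hN : Module.Injective Rᵐᵒᵖ N) :
    Module.Projective R (CoDual N Q) := by
  let p : (CoDual N Q →₀ R) →ₗ[R] CoDual N Q := Finsupp.linearCombination R id
  have hp : Function.Surjective p := Finsupp.linearCombination_id_surjective R _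
  refine projective_of_ker_inf_jacobson_le hp ?_
  rintro x ⟨hx, hx'⟩
  obtain ⟨ι, _, a, y, ha, rfl⟩ := exists_sum_of_mem_ideal_smul hx'
  have h0 : ∑ i, a i • p (y i) = 0 := by simpa using hx
  obtain ⟨l, z, ψ, hz, hψ⟩ := CoDual.exists_of_sum_smul_eq_zero hQ hN a _ h0
  choose q hq using fun s => hp (ψ s)
  -- Subtracting this vanishing sum from `x` leaves coefficients `a i ∈ J` on elements of the kernel
  -- of `p`.
  have hsum : ∑ i, a i • (∑ s, z s i • q s) = 0 := by
    simp_rw [Finset.smul_sum, smul_smul]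
    rw [Finset.sum_comm]
    refine Finset.sum_eq_zero fun s _ => ?_
    rw [← Finset.sum_smul, hz, zero_smul]
  rw [← sub_zero (∑ i, a i • y i), ← hsum, ← Finset.sum_sub_distrib]
  refine Submodule.sum_mem _ fun i _ => ?_
  rw [← smul_sub]
  refine Submodule.smul_mem_smul (ha i) ?_
  rw [LinearMap.mem_ker, map_sub, hψ, map_sum]
  simp [hq]

end Semiprimary

/-! ### Factoring through surjections and injections. -/

section Factorization

variable {S : Type*} [Ring S] {X Y Z : Type*} [AddCommGroup X] [Module S X]
  [AddCommGroup Y] [Module S Y] [AddCommGroup Z] [Module S Z]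

theorem exists_desc {g : X →ₗ[S] Y} (hg : Function.Surjective g) (ν : X →ₗ[S] Z)
    (h : ∀ x, g x = 0 → ν x = 0) : ∃ μ : Y →ₗ[S] Z, ∀ x, μ (g x) = ν x := by
  refine ⟨(LinearMap.ker g).liftQ ν h ∘ₗ
    ((g.quotKerEquivOfSurjective hg).symm : Y →ₗ[S] _), fun x => ?_⟩
  have hx : (g.quotKerEquivOfSurjective hg).symm (g x) = Submodule.Quotient.mk x := by
    rw [LinearEquiv.symm_apply_eq]; rfl
  rw [LinearMap.comp_apply, LinearEquiv.coe_coe, hx]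
  rfl

theorem exists_lift {f : X →ₗ[S] Y} (hf : Function.Injective f) (ν : Z →ₗ[S] Y)
    (h : ∀ z, ∃ x, f x = ν z) : ∃ μ : Z →ₗ[S] X, ∀ z, f (μ z) = ν z := by
  refine ⟨((LinearEquiv.ofInjective f hf).symm : _ →ₗ[S] X) ∘ₗ
    LinearMap.codRestrict (LinearMap.range f) ν h, fun z => ?_⟩
  have := (LinearEquiv.ofInjective f hf).apply_symm_apply
    (LinearMap.codRestrict (LinearMap.range f) ν h z)
  exact congrArg Subtype.val this

end Factorization

/-! ### Cosyzygies in a minimal injective coresolution. -/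

section Cosyzygy

variable {R : Type u} [Ring R] {M : Type u} [AddCommGroup M] [Module R M]

namespace MinimalInjectiveCoresolution

variable (C : MinimalInjectiveCoresolution R M)

/-- The cosyzygies of `M` in a minimal injective coresolution. -/
def cosyzygy : ℕ → ModuleCat.{u} R
  | 0 => ModuleCat.of R M
  | j + 1 => ModuleCat.of R (LinearMap.range (C.d j))

/-- The inclusion of a cosyzygy. -/
def incl : ∀ j, C.cosyzygy j →ₗ[R] C.E j
  | 0 => C.ε
  | j + 1 => (LinearMap.range (C.d j)).subtype

/-- The projection to the next cosyzygy. -/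
def toCosyzygy (j : ℕ) : C.E j →ₗ[R] C.cosyzygy (j + 1) := (C.d j).rangeRestrict

theorem envelope_incl : ∀ j, IsInjectiveEnvelope R (C.incl j)
  | 0 => C.envelope_zero
  | j + 1 => C.envelope_succ j

theorem injective_E (j : ℕ) : Module.Injective R (C.E j) := (C.envelope_incl j).injective

theorem isShortExact_incl (j : ℕ) : IsShortExact (C.incl j) (C.toCosyzygy j) := by
  refine ⟨?_, ?_, LinearMap.surjective_rangeRestrict _⟩
  · cases j with
    | zero => exact C.injective_ε
    | succ j => exact Subtype.val_injective
  · intro x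
    have h1 : C.toCosyzygy j x = 0 ↔ C.d j x = 0 := Subtype.ext_iff
    rw [h1]
    cases j with
    | zero => exact C.exact_zero x
    | succ j =>
      rw [C.exact_succ j x]
      exact ⟨fun h => ⟨⟨x, h⟩, rfl⟩, by rintro ⟨y, rfl⟩; exact y.2⟩

end MinimalInjectiveCoresolution

end Cosyzygy

/-! ### The `G_n(k)` condition without minimality, and its closure properties. -/

section HasG

variable {R : Type u} [Ring R]

/-- `M` has an injective coresolution, not necessarily minimal, whose `i`-th term has projective
dimension at most `k + i` for `i < n`. -/
def HasG (R : Type u) [Ring R] : ℕ → ℕ → ∀ (M : Type u) [AddCommGroup M] [Module R M], Prop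
  | 0, _, _, _, _ => True
  | n + 1, k, M, _, _ => ∃ (E M' : ModuleCat.{u} R) (f : M →ₗ[R] E) (g : E →ₗ[R] M'),
      Module.Injective R E ∧ PdLE R k E ∧ IsShortExact f g ∧ HasG R n (k + 1) M'

variable {M : Type u} [AddCommGroup M] [Module R M]

theorem HasG.mono {n n' k k' : ℕ} (h : HasG R n k M) (hn : n' ≤ n) (hk : k ≤ k') :
    HasG R n' k' M := by
  induction n' generalizing n k k' M with
  | zero => trivial
  | succ n' ih =>
    obtain _ | n := n
    · exact absurd hn (by lia)
    obtain ⟨E, M', f, g, hE, hpd, hs, hM'⟩ := h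
    exact ⟨E, M', f, g, hE, hpd.mono hk, hs, ih hM' (by lia) (by lia)⟩

theorem MinimalInjectiveCoresolution.hasG_cosyzygy (C : MinimalInjectiveCoresolution R M)
    (n k j : ℕ) (h : ∀ i, i < n → PdLE R (k + i) (C.E (j + i))) :
    HasG R n k (C.cosyzygy j) := by
  induction n generalizing j k with
  | zero => trivial
  | succ n ih =>
    refine ⟨C.E j, C.cosyzygy (j + 1), C.incl j, C.toCosyzygy j, C.injective_E j,
      h 0 (by lia), C.isShortExact_incl j, ih _ _ fun i hi => ?_⟩
    have := h (i + 1) (by lia)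
    rwa [show j + 1 + i = j + (i + 1) by lia, show k + 1 + i = k + (i + 1) by lia]

theorem IsG.hasG [IsSemiprimaryRing R] {n k : ℕ} (h : IsG R n k M) : HasG R n k M := by
  obtain ⟨C, hC⟩ := h
  exact C.hasG_cosyzygy n k 0 fun i hi => by
    rw [zero_add]
    exact (hC i hi).pdLE

/-- Minimality makes each term a direct summand of the matching term of any other injective
coresolution, and the retraction descends to the next cosyzygies. Stating it for a retract `F` of
the cosyzygy keeps the induction going. -/
theorem MinimalInjectiveCoresolution.pdLE_of_retract (C : MinimalInjectiveCoresolution R M)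
    (n k j : ℕ) {F : Type u} [AddCommGroup F] [Module R F] (s : C.cosyzygy j →ₗ[R] F)
    (r : F →ₗ[R] C.cosyzygy j) (hrs : ∀ x, r (s x) = x) (h : HasG R n k F) :
    ∀ i, i < n → PdLE R (k + i) (C.E (j + i)) := by
  induction n generalizing j k F with
  | zero => intro i hi; exact absurd hi (by lia)
  | succ n ih =>
    obtain ⟨E, F', f, g, hE, hpd, hfg, hF'⟩ := h
    have hC := C.isShortExact_incl j
    obtain ⟨α, hα⟩ := (Module.Baer.of_injective hE).extension_property (C.incl j) hC.1 (f ∘ₗ s)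
    obtain ⟨β, hβ⟩ := (Module.Baer.of_injective (C.injective_E j)).extension_property f hfg.1
      (C.incl j ∘ₗ r)
    have hα' : ∀ x, α (C.incl j x) = f (s x) := DFunLike.congr_fun hα
    have hβ' : ∀ x, β (f x) = C.incl j (r x) := DFunLike.congr_fun hβ
    have hfix : ∀ x, β (α (C.incl j x)) = C.incl j x := fun x => by rw [hα', hβ', hrs]
    let u := LinearEquiv.ofBijective (β ∘ₗ α)
      ((C.envelope_incl j).left_minimal (β ∘ₗ α) (LinearMap.ext hfix))
    let β₁ : E →ₗ[R] C.E j := (u.symm : C.E j →ₗ[R] C.E j) ∘ₗ β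
    have hβα : ∀ x, β₁ (α x) = x := fun x => u.symm_apply_apply x
    have hβ₁ : ∀ x, β₁ (f x) = C.incl j (r x) := fun x => by
      change u.symm (β (f x)) = _
      rw [hβ', LinearEquiv.symm_apply_eq]
      exact (hfix _).symm
    obtain ⟨s', hs'⟩ := exists_desc hC.2.2 (g ∘ₗ α) fun x hx => by
      obtain ⟨y, rfl⟩ := (hC.2.1 x).1 hx
      rw [LinearMap.comp_apply, hα']
      exact hfg.2.1.apply_apply_eq_zero _
    obtain ⟨r', hr'⟩ := exists_desc hfg.2.2 (C.toCosyzygy j ∘ₗ β₁) fun x hx => by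
      obtain ⟨y, rfl⟩ := (hfg.2.1 x).1 hx
      rw [LinearMap.comp_apply, hβ₁]
      exact hC.2.1.apply_apply_eq_zero _
    intro i hi
    obtain _ | i := i
    · exact hpd.of_retract α β₁ (LinearMap.ext hβα)
    · have := ih (k + 1) (j + 1) s' r' (fun x => by
        obtain ⟨y, rfl⟩ := hC.2.2 x
        rw [hs', LinearMap.comp_apply, hr', LinearMap.comp_apply, hβα]) hF' i (by lia)
      rwa [show j + 1 + i = j + (i + 1) by lia, show k + 1 + i = k + (i + 1) by lia] at this

/-- The class of modules `M` with `HasG R n k M` is closed under extensions. -/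
theorem HasG.extension {n k : ℕ} {A B C : Type u} [AddCommGroup A] [Module R A]
    [AddCommGroup B] [Module R B] [AddCommGroup C] [Module R C] {f : A →ₗ[R] B} {g : B →ₗ[R] C}
    (hs : IsShortExact f g) (hA : HasG R n k A) (hC : HasG R n k C) : HasG R n k B := by
  induction n generalizing k A B C with
  | zero => trivial
  | succ n ih =>
    obtain ⟨EA, A', fA, gA, hEA, hpA, hsA, hA'⟩ := hA
    obtain ⟨EC, C', fC, gC, hEC, hpC, hsC, hC'⟩ := hC
    obtain ⟨b, hb⟩ := (Module.Baer.of_injective hEA).extension_property f hs.1 fA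
    have hb' : ∀ x, b (f x) = fA x := DFunLike.congr_fun hb
    let j : B →ₗ[R] EA × EC := b.prod (fC ∘ₗ g)
    -- Horseshoe construction: `B` embeds in `EA × EC`, and the cokernel is an extension of `C'` by
    -- `A'`.
    have hj : Function.Injective j := by
      rw [injective_iff_map_eq_zero]
      intro y hy
      have h1 : b y = 0 := congrArg Prod.fst hy
      have h2 : fC (g y) = 0 := congrArg Prod.snd hy
      obtain ⟨a, rfl⟩ := (hs.2.1 y).1 (hsC.1 (h2.trans (map_zero _).symm))
      rw [hb'] at h1
      rw [hsA.1 (h1.trans (map_zero _).symm), map_zero]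
    have hQ := isShortExact_mkQ hj
    obtain ⟨f', hf'⟩ := exists_desc hsA.2.2 ((LinearMap.range j).mkQ ∘ₗ LinearMap.inl R EA EC)
      fun x hx => by
        obtain ⟨a, rfl⟩ := (hsA.2.1 x).1 hx
        refine (hQ.2.1 _).2 ⟨f a, ?_⟩
        exact Prod.ext (hb' a) ((congrArg fC (hs.2.1.apply_apply_eq_zero a)).trans (map_zero _))
    obtain ⟨g', hg'⟩ := exists_desc hQ.2.2 (gC ∘ₗ LinearMap.snd R EA EC) fun x hx => by
      obtain ⟨y, rfl⟩ := (hQ.2.1 x).1 hx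
      exact hsC.2.1.apply_apply_eq_zero _
    have hs' : IsShortExact f' g' := by
      refine ⟨(injective_iff_map_eq_zero _).2 fun a ha => ?_, fun q => ⟨fun hq => ?_, ?_⟩,
        fun c => ?_⟩
      · obtain ⟨e, rfl⟩ := hsA.2.2 a
        rw [hf'] at ha
        obtain ⟨y, hy⟩ := (hQ.2.1 _).1 ha
        have h1 : b y = e := congrArg Prod.fst hy
        have h2 : fC (g y) = 0 := congrArg Prod.snd hy
        obtain ⟨a, rfl⟩ := (hs.2.1 y).1 (hsC.1 (h2.trans (map_zero _).symm))
        rw [← h1, hb']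
        exact hsA.2.1.apply_apply_eq_zero _
      · obtain ⟨⟨e, e'⟩, rfl⟩ := hQ.2.2 q
        rw [hg'] at hq
        obtain ⟨c, hc⟩ := (hsC.2.1 e').1 hq
        obtain ⟨y, rfl⟩ := hs.2.2 c
        -- Modulo `j y`, the pair `(e, e')` equals `(e - b y, 0)`.
        refine ⟨gA (e - b y), ?_⟩
        rw [hf', ← sub_eq_zero, LinearMap.comp_apply, ← map_sub]
        refine (hQ.2.1 _).2 ⟨-y, ?_⟩
        rw [map_neg]
        refine Prod.ext ?_ ?_
        · simp [j]
        · simp [j, hc]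
      · rintro ⟨a, rfl⟩
        obtain ⟨e, rfl⟩ := hsA.2.2 a
        rw [hf', LinearMap.comp_apply, hg']
        simp
      · obtain ⟨e, rfl⟩ := hsC.2.2 c
        exact ⟨(LinearMap.range j).mkQ (0, e), hg' _⟩
    have := hEA
    have := hEC
    refine ⟨ModuleCat.of R (EA × EC), ModuleCat.of R ((EA × EC) ⧸ LinearMap.range j), j, _,
      ?_, hpA.prod hpC, hQ, ih hs' hA' hC'⟩
    refine Module.Baer.injective fun I g => ?_
    obtain ⟨h₁, hh₁⟩ := Module.Baer.of_injective hEA I (LinearMap.fst R EA EC ∘ₗ g)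
    obtain ⟨h₂, hh₂⟩ := Module.Baer.of_injective hEC I (LinearMap.snd R EA EC ∘ₗ g)
    exact ⟨h₁.prod h₂, fun x hx => Prod.ext (hh₁ x hx) (hh₂ x hx)⟩

/-- Embed `N` in the first injective `E` of `V`. Then `E / N` is an extension of `V' = E / V` by `N'
= V / N`, and both satisfy the condition with `n` and `k + 1`. -/
theorem HasG.of_isShortExact {n k : ℕ} {N V N' : Type u} [AddCommGroup N] [Module R N]
    [AddCommGroup V] [Module R V] [AddCommGroup N'] [Module R N'] {f : N →ₗ[R] V} {g : V →ₗ[R] N'}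
    (hs : IsShortExact f g) (hV : HasG R (n + 1) k V) (hN' : HasG R n (k + 1) N') :
    HasG R (n + 1) k N := by
  obtain ⟨E, V', fV, gV, hE, hp, hsV, hV'⟩ := hV
  have hQ := isShortExact_mkQ (f := fV ∘ₗ f) (hsV.1.comp hs.1)
  refine ⟨E, ModuleCat.of R (E ⧸ LinearMap.range (fV ∘ₗ f)), fV ∘ₗ f, _, hE, hp, hQ, ?_⟩
  obtain ⟨f', hf'⟩ := exists_desc hs.2.2 ((LinearMap.range (fV ∘ₗ f)).mkQ ∘ₗ fV)
    fun x hx => by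
      obtain ⟨a, rfl⟩ := (hs.2.1 x).1 hx
      exact (hQ.2.1 _).2 ⟨a, rfl⟩
  obtain ⟨g', hg'⟩ := exists_desc hQ.2.2 gV fun x hx => by
    obtain ⟨y, rfl⟩ := (hQ.2.1 x).1 hx
    exact hsV.2.1.apply_apply_eq_zero _
  refine HasG.extension (f := f') (g := g') ⟨(injective_iff_map_eq_zero _).2 fun a ha => ?_,
    fun q => ⟨fun hq => ?_, ?_⟩, fun c => ?_⟩ hN' hV'
  · obtain ⟨v, rfl⟩ := hs.2.2 a
    rw [hf'] at ha
    obtain ⟨y, hy⟩ := (hQ.2.1 _).1 ha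
    rw [← hsV.1 hy]
    exact hs.2.1.apply_apply_eq_zero _
  · obtain ⟨e, rfl⟩ := hQ.2.2 q
    rw [hg'] at hq
    obtain ⟨v, rfl⟩ := (hsV.2.1 e).1 hq
    exact ⟨g v, hf' v⟩
  · rintro ⟨a, rfl⟩
    obtain ⟨v, rfl⟩ := hs.2.2 a
    rw [hf', LinearMap.comp_apply, hg']
    exact hsV.2.1.apply_apply_eq_zero _
  · obtain ⟨e, rfl⟩ := hsV.2.2 c
    exact ⟨(LinearMap.range (fV ∘ₗ f)).mkQ e, hg' _⟩

end HasG

/-! ### Direct sums of copies of a module. -/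

section Finsupp

variable {R : Type u} [Ring R] (X : Type u)

theorem IsShortExact.finsupp {A B C : Type u} [AddCommGroup A] [Module R A]
    [AddCommGroup B] [Module R B] [AddCommGroup C] [Module R C] {f : A →ₗ[R] B} {g : B →ₗ[R] C}
    (hs : IsShortExact f g) :
    IsShortExact (Finsupp.mapRange.linearMap (α := X) f) (Finsupp.mapRange.linearMap g) := by
  refine ⟨Finsupp.mapRange_injective _ (map_zero f) hs.1, fun b => ⟨fun hb => ?_, ?_⟩,
    Finsupp.mapRange_surjective _ (map_zero g) hs.2.2⟩
  · have h : ∀ x, ∃ a, f a = b x := fun x => (hs.2.1 (b x)).1 (DFunLike.congr_fun hb x)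
    choose a ha using h
    refine ⟨Finsupp.onFinset b.support a fun x hx => ?_, Finsupp.ext fun x => by simp [ha]⟩
    rw [Finsupp.mem_support_iff, ← ha]
    exact fun h0 => hx (hs.1 (h0.trans (map_zero f).symm))
  · rintro ⟨a, rfl⟩
    ext x
    simp [hs.2.1.apply_apply_eq_zero]

theorem PdLE.finsupp {d : ℕ} {M : Type u} [AddCommGroup M] [Module R M] (h : PdLE R d M) :
    PdLE R d (X →₀ M) := by
  classical
  induction d generalizing M with
  | zero =>
    have := pdLE_zero_iff.1 h
    exact pdLE_zero_iff.2 (Module.Projective.of_equiv (finsuppLequivDFinsupp R).symm)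
  | succ d ih =>
    have hs := isShortExact_ker (Finsupp.linearCombination_id_surjective R M)
    have hfree : PdLE R d (M →₀ R) := (pdLE_zero_iff.2 inferInstance).mono (Nat.zero_le _)
    exact (hs.finsupp X).pdLE_right (ih (hs.pdLE_left hfree h)) ((ih hfree).mono (by lia))

/-- Direct sums of an injective module over a noetherian ring are injective. -/
theorem injective_finsupp [IsNoetherianRing R] {E : Type u} [AddCommGroup E] [Module R E]
    (hE : Module.Injective R E) : Module.Injective R (X →₀ E) := by
  classical
  refine Module.Baer.injective fun I g => ?_
  obtain ⟨l, z, hz⟩ := Submodule.fg_iff_exists_fin_generating_family.1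
    (IsNoetherian.noetherian (⊤ : Submodule R I))
  -- The ideal is finitely generated, so `g` takes values in the finite subsum indexed by `s`.
  let s : Finset X := Finset.univ.biUnion fun i => (g (z i)).support
  have hg : ∀ y x, x ∉ s → g y x = 0 := by
    intro y x hx
    have : (⊤ : Submodule R I) ≤ LinearMap.ker (Finsupp.lapply x ∘ₗ g) := by
      rw [← hz, Submodule.span_le]
      rintro _ ⟨i, rfl⟩
      by_contra h0
      exact hx (Finset.mem_biUnion.2 ⟨i, Finset.mem_univ _, Finsupp.mem_support_iff.2 h0⟩)
    exact this (Submodule.mem_top (x := y))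
  choose h hh using fun x => Module.Baer.of_injective hE I (Finsupp.lapply x ∘ₗ g)
  refine ⟨∑ x ∈ s, Finsupp.lsingle x ∘ₗ h x, fun y hy => Finsupp.ext fun x => ?_⟩
  rw [LinearMap.sum_apply, Finsupp.finsetSum_apply]
  by_cases hx : x ∈ s
  · rw [Finset.sum_eq_single x (fun b _ hb => by simp [hb]) fun h => absurd hx h]
    simpa using hh x y hy
  · rw [hg _ x hx]
    refine Finset.sum_eq_zero fun b hb => ?_
    have : b ≠ x := fun h => hx (h ▸ hb)
    simp [this]

theorem HasG.finsupp [IsNoetherianRing R] {n k : ℕ} {M : Type u} [AddCommGroup M] [Module R M]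
    (h : HasG R n k M) : HasG R n k (X →₀ M) := by
  induction n generalizing k M with
  | zero => trivial
  | succ n ih =>
    obtain ⟨E, M', f, g, hE, hpd, hs, hM'⟩ := h
    exact ⟨ModuleCat.of R (X →₀ E), ModuleCat.of R (X →₀ M'), _, _, injective_finsupp X hE,
      hpd.finsupp X, hs.finsupp X, ih hM'⟩

end Finsupp

/-! ### Injective envelopes, minimal coresolutions, and independence of the coresolution. -/

section Envelope

variable {R : Type u} [Ring R]

theorem exists_injective_embedding {S : Type*} [Ring S] [Small.{u} S] (M : Type u)
    [AddCommGroup M] [Module S M] :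
    ∃ (E : ModuleCat.{u} S) (f : M →ₗ[S] E), Module.Injective S E ∧ Function.Injective f := by
  obtain ⟨I, _, f, _⟩ := EnoughInjectives.presentation (ModuleCat.of S M)
  exact ⟨I, f.hom, Module.injective_module_of_injective_object S I,
    (ModuleCat.mono_iff_injective f).1 inferInstance⟩

/-- `A` meets every nonzero submodule of `B`. -/
def EssentialIn {E : Type u} [AddCommGroup E] [Module R E] (A B : Submodule R E) : Prop :=
  A ≤ B ∧ ∀ C ≤ B, C ⊓ A = ⊥ → C = ⊥

theorem exists_maximal_essentialIn {E : Type u} [AddCommGroup E] [Module R E]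
    (A : Submodule R E) : ∃ B, Maximal (EssentialIn A) B := by
  obtain ⟨B, -, hB⟩ := zorn_le_nonempty₀ {B | EssentialIn A B} (fun c hc hchain B₀ hB₀ => by
    refine ⟨sSup c, ⟨(hc hB₀).1.trans (le_sSup hB₀), fun C hC hCA => ?_⟩, fun B hB => le_sSup hB⟩
    rw [eq_bot_iff]
    intro x hx
    obtain ⟨B, hB, hxB⟩ := (Submodule.mem_sSup_of_directed ⟨B₀, hB₀⟩ hchain.directedOn).1 (hC hx)
    have h1 : Submodule.span R {x} = ⊥ := by
      refine (hc hB).2 _ ((Submodule.span_singleton_le_iff_mem _ _).2 hxB) ?_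
      rw [eq_bot_iff, ← hCA]
      exact inf_le_inf_right _ ((Submodule.span_singleton_le_iff_mem _ _).2 hx)
    exact Submodule.span_singleton_eq_bot.1 h1) A
    ⟨le_rfl, fun C hC hCA => by rwa [inf_eq_left.2 hC] at hCA⟩
  exact ⟨B, hB⟩

theorem exists_maximal_disjoint {E : Type u} [AddCommGroup E] [Module R E]
    (B : Submodule R E) : ∃ K, Maximal (fun K => K ⊓ B = ⊥) K := by
  obtain ⟨K, -, hK⟩ := zorn_le_nonempty₀ {K | K ⊓ B = ⊥} (fun c hc hchain K₀ hK₀ => by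
    refine ⟨sSup c, ?_, fun B hB => le_sSup hB⟩
    rw [Set.mem_ofPred_eq, eq_bot_iff]
    rintro x ⟨hx, hxB⟩
    obtain ⟨K, hK, hxK⟩ := (Submodule.mem_sSup_of_directed ⟨K₀, hK₀⟩ hchain.directedOn).1 hx
    rw [← hc hK]
    exact ⟨hxK, hxB⟩) ⊥ (bot_inf_eq B)
  exact ⟨K, hK⟩

/-- A maximal essential extension inside an injective module is a retract. -/
theorem exists_retraction_of_maximal_essentialIn {E : Type u} [AddCommGroup E] [Module R E]
    (hE : Module.Injective R E) {A B : Submodule R E} (hB : Maximal (EssentialIn A) B) :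
    ∃ ρ : E →ₗ[R] B, ∀ b : B, ρ b = b := by
  obtain ⟨K, hK⟩ := exists_maximal_disjoint B
  have hker : LinearMap.ker (K.mkQ ∘ₗ B.subtype) ≤ LinearMap.ker B.subtype := by
    intro b hb
    have : (b : E) ∈ K ⊓ B := ⟨(Submodule.Quotient.mk_eq_zero _).1 hb, b.2⟩
    rw [hK.prop] at this
    exact this
  obtain ⟨h, hh⟩ := exists_comp_eq_of_ker_le (Module.Baer.of_injective hE) _ _ hker
  have hh' : ∀ b ∈ B, h (K.mkQ b) = b := fun b hb => DFunLike.congr_fun hh ⟨b, hb⟩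
  let t : E →ₗ[R] E := h ∘ₗ K.mkQ
  have hKt : K ≤ LinearMap.ker t := fun x hx => by
    change h (K.mkQ x) = 0
    rw [show K.mkQ x = 0 from (Submodule.Quotient.mk_eq_zero _).2 hx, map_zero]
  -- The map `t` fixes `B`, so the preimage of a submodule disjoint from `B` is disjoint from `B`
  -- and lies in `K`, which `t` kills. Hence `range t` is essential over `A`, and maximality of `B`
  -- forces `range t ≤ B`.
  have hmax : ∀ C : Submodule R E, C ⊓ B = ⊥ → C.comap t ≤ K := by
    intro C hC
    refine hK.2 ?_ (hKt.trans (LinearMap.ker_le_comap t))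
    change _ ⊓ _ = _
    rw [eq_bot_iff, ← hC]
    rintro b ⟨hb, hbB⟩
    refine ⟨?_, hbB⟩
    have : t b ∈ C := hb
    rwa [show t b = b from hh' b hbB] at this
  have hrange : EssentialIn A (LinearMap.range t) := by
    refine ⟨fun a ha => ⟨a, hh' a (hB.prop.1 ha)⟩, fun C hC hCA => ?_⟩
    have h1 : C ⊓ B = ⊥ := hB.prop.2 _ inf_le_right (by
      rw [eq_bot_iff, ← hCA]
      exact inf_le_inf_right _ inf_le_left)
    rw [eq_bot_iff]
    intro x hx
    obtain ⟨y, rfl⟩ := hC hx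
    exact hKt (hmax C h1 hx)
  have hle : LinearMap.range t ≤ B := hB.2 hrange fun b hb => ⟨b, hh' b hb⟩
  exact ⟨LinearMap.codRestrict B t fun x => hle ⟨x, rfl⟩,
    fun b => Subtype.ext (hh' b b.2)⟩

theorem exists_isInjectiveEnvelope (M : Type u) [AddCommGroup M] [Module R M] :
    ∃ (E : ModuleCat.{u} R) (f : M →ₗ[R] E),
      Function.Injective f ∧ IsInjectiveEnvelope R f := by
  obtain ⟨E, i, hE, hi⟩ := exists_injective_embedding (S := R) M
  obtain ⟨B, hB⟩ := exists_maximal_essentialIn (LinearMap.range i)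
  obtain ⟨ρ, hρ⟩ := exists_retraction_of_maximal_essentialIn hE hB
  let f : M →ₗ[R] B := LinearMap.codRestrict B i fun x => hB.prop.1 ⟨x, rfl⟩
  have hf : Function.Injective f := fun x y hxy => hi (congrArg Subtype.val hxy)
  have hBinj : Module.Injective R B := by
    constructor
    intro X Y _ _ _ _ g hg ν
    obtain ⟨μ, hμ⟩ := (Module.Baer.of_injective hE).extension_property g hg (B.subtype ∘ₗ ν)
    refine ⟨ρ ∘ₗ μ, fun x => ?_⟩
    rw [LinearMap.comp_apply, show μ (g x) = (ν x : E) from DFunLike.congr_fun hμ x, hρ]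
  have hess : ∀ u : B →ₗ[R] B, u ∘ₗ f = f → Function.Injective u := by
    intro u hu
    suffices h : (LinearMap.ker u).map B.subtype = ⊥ by
      refine (injective_iff_map_eq_zero u).2 fun b hb => Subtype.ext ?_
      have hb' : (b : E) ∈ (LinearMap.ker u).map B.subtype := ⟨b, hb, rfl⟩
      rwa [h] at hb'
    refine hB.prop.2 _ (Submodule.map_subtype_le _ _) ?_
    rw [eq_bot_iff]
    rintro _ ⟨⟨b, hb, rfl⟩, ⟨m, hm⟩⟩
    have hbm : b = f m := Subtype.ext hm.symm
    have h0 : f m = 0 := by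
      rw [← hu, LinearMap.comp_apply, ← hbm]
      exact hb
    rw [hbm, h0]
    simp
  refine ⟨ModuleCat.of R B, f, hf, hBinj, fun E' _ _ hE' g =>
    (Module.Baer.of_injective hE').extension_property f hf g, fun u hu => ⟨hess u hu, ?_⟩⟩
  -- A left inverse `v` of `u` also fixes `f`, so `v` is injective too and `u` is onto.
  obtain ⟨v, hv⟩ := (Module.Baer.of_injective hBinj).extension_property u (hess u hu) LinearMap.id
  have hvf : v ∘ₗ f = f := by
    nth_rewrite 1 [← hu]
    rw [← LinearMap.comp_assoc, hv, LinearMap.id_comp]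
  exact fun b => ⟨v b, hess v hvf (DFunLike.congr_fun hv (v b))⟩

theorem IsInjectiveEnvelope.range_subtype {M E : Type u} [AddCommGroup M] [Module R M]
    [AddCommGroup E] [Module R E] {f : M →ₗ[R] E} (h : IsInjectiveEnvelope R f) :
    IsInjectiveEnvelope R (LinearMap.range f).subtype where
  injective := h.injective
  factors _ _ _ hE' g := (Module.Baer.of_injective hE').extension_property _
    Subtype.val_injective g
  left_minimal u hu := h.left_minimal u
    (LinearMap.ext fun x => DFunLike.congr_fun hu ⟨f x, x, rfl⟩)

theorem nonempty_minimalInjectiveCoresolution (M : Type u) [AddCommGroup M] [Module R M] :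
    Nonempty (MinimalInjectiveCoresolution R M) := by
  have hex : ∀ X : ModuleCat.{u} R, ∃ (E X' : ModuleCat.{u} R) (f : X →ₗ[R] E) (g : E →ₗ[R] X'),
      IsShortExact f g ∧ IsInjectiveEnvelope R f := fun X => by
    obtain ⟨E, f, hf, hE⟩ := exists_isInjectiveEnvelope (R := R) X
    exact ⟨E, ModuleCat.of R (E ⧸ LinearMap.range f), f, _, isShortExact_mkQ hf, hE⟩
  choose env next e q hs henv using hex
  let X : ℕ → ModuleCat.{u} R := fun j => Nat.rec (ModuleCat.of R M) (fun _ Y => next Y) j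
  have hker : ∀ j x, e (X (j + 1)) (q (X j) x) = 0 ↔ x ∈ Set.range (e (X j)) := fun j x => by
    rw [map_eq_zero_iff _ (hs (X (j + 1))).1]
    exact (hs (X j)).2.1 x
  exact ⟨{
    E := fun j => env (X j)
    ε := e (X 0)
    d := fun j => e (X (j + 1)) ∘ₗ q (X j)
    injective_ε := (hs _).1
    exact_zero := fun x => hker 0 x
    exact_succ := fun j x => (hker (j + 1) x).trans
      ⟨fun ⟨y, hy⟩ => by
        obtain ⟨z, rfl⟩ := (hs (X j)).2.2 y
        exact ⟨z, hy⟩, fun ⟨z, hz⟩ => ⟨q (X j) z, hz⟩⟩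
    envelope_zero := henv _
    envelope_succ := fun j => by
      rw [LinearMap.range_comp_of_range_eq_top _ (LinearMap.range_eq_top.2 (hs (X j)).2.2)]
      exact (henv (X (j + 1))).range_subtype }⟩

theorem HasG.isG {n k : ℕ} {M : Type u} [AddCommGroup M] [Module R M] (h : HasG R n k M) :
    IsG R n k M := by
  obtain ⟨C⟩ := nonempty_minimalInjectiveCoresolution (R := R) M
  refine ⟨C, fun i hi => FlatDimLE.of_pdLE ?_⟩
  have := C.pdLE_of_retract n k 0 (F := M) LinearMap.id LinearMap.id (fun _ => rfl) h i hi
  rwa [zero_add] at this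

theorem HasG.of_retract {n k : ℕ} {M F : Type u} [AddCommGroup M] [Module R M] [AddCommGroup F]
    [Module R F] (s : M →ₗ[R] F) (r : F →ₗ[R] M) (hrs : r ∘ₗ s = LinearMap.id)
    (h : HasG R n k F) : HasG R n k M := by
  obtain ⟨C⟩ := nonempty_minimalInjectiveCoresolution (R := R) M
  exact C.hasG_cosyzygy n k 0
    (C.pdLE_of_retract n k 0 (F := F) s r (fun x => DFunLike.congr_fun hrs x) h)

/-- A projective module is a retract of a direct sum of copies of `R`. -/
theorem HasG.of_projective [IsNoetherianRing R] {n k : ℕ} (h : HasG R n k R) (V : Type u)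
    [AddCommGroup V] [Module R V] [Module.Projective R V] : HasG R n k V := by
  obtain ⟨s, hs⟩ := Module.projective_def'.1 (inferInstance : Module.Projective R V)
  exact (h.finsupp V).of_retract s _ hs

end Envelope

/-! ### Projective resolutions obtained by dualizing the coresolution of the right module `R`. -/

section Resolution

variable {R : Type u} [Ring R]

/-- A projective resolution `⋯ → P 1 → P 0 → Z 0 → 0` of an injective module, with syzygies `Z j`,
such that the injective dimension of `P j` is at most `k + j` for `j < n`. -/
structure BoundedResolution (R : Type u) [Ring R] (n k : ℕ) where
  Z : ℕ → ModuleCat.{u} R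
  P : ℕ → ModuleCat.{u} R
  ι : ∀ j, Z (j + 1) →ₗ[R] P j
  π : ∀ j, P j →ₗ[R] Z j
  exact : ∀ j, IsShortExact (ι j) (π j)
  projective : ∀ j, Module.Projective R (P j)
  idLE : ∀ j, j < n → IdLE R (k + j) (P j)
  injective_zero : Module.Injective R (Z 0)

theorem BoundedResolution.idLE_Z {n k : ℕ} (T : BoundedResolution R n k) (j : ℕ) (hj : j ≤ n) :
    IdLE R (k + j) (T.Z j) := by
  induction j with
  | zero => exact (idLE_zero_iff.2 T.injective_zero).mono (Nat.zero_le _)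
  | succ j ih =>
    exact (T.exact j).idLE_left ((T.idLE j (by lia)).mono (by lia)) (ih (by lia))

/-- If the right module `R` is `G_n(k)`, then every left module embeds into an injective one with a
projective resolution whose terms have bounded injective dimension. -/
theorem exists_boundedResolution [IsSemiprimaryRing R] [IsNoetherianRing Rᵐᵒᵖ] {n k : ℕ}
    (h : IsG Rᵐᵒᵖ n k R) (M : Type u) [AddCommGroup M] [Module R M] :
    ∃ (T : BoundedResolution R n k) (f : M →ₗ[R] T.Z 0), Function.Injective f := by
  obtain ⟨C, hC⟩ := h
  obtain ⟨Q, i, hQ', hi⟩ := exists_injective_embedding (S := ℤ) M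
  -- The `ℤ`-action carried by `Q` is replaced by the canonical one used for additive maps.
  have hQ : @Module.Baer ℤ _ Q _ (AddCommGroup.toIntModule Q) := by
    convert Module.Baer.of_injective hQ'
    exact Subsingleton.elim _ _
  have hR : IsFlat Rᵐᵒᵖ R := by
    have : Module.Projective Rᵐᵒᵖ R := Module.Projective.of_equiv'
      ({ MulOpposite.opAddEquiv.symm with map_smul' := fun _ _ => rfl } : Rᵐᵒᵖ ≃ₗ[Rᵐᵒᵖ] R)
    exact isFlat_of_projective R
  let T : BoundedResolution R n k :=
    { Z := fun j => ModuleCat.of R (CoDual (C.cosyzygy j) Q)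
      P := fun j => ModuleCat.of R (CoDual (C.E j) Q)
      ι := fun j => CoDual.map Q (C.toCosyzygy j)
      π := fun j => CoDual.map Q (C.incl j)
      exact := fun j => ⟨CoDual.map_injective (C.isShortExact_incl j).2.2,
        CoDual.map_exact (C.isShortExact_incl j).2.1 hQ,
        CoDual.map_surjective hQ (C.isShortExact_incl j).1⟩
      projective := fun j => projective_coDual hQ (C.injective_E j)
      idLE := fun j hj => (hC j hj).idLE_coDual hQ
      injective_zero := hR.injective_coDual hQ }
  -- An element `m` goes to `r ↦ i (r • m)`; evaluation at `1` recovers `i m`.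
  let f : M →ₗ[R] CoDual R Q :=
    { toFun := fun m => AddMonoidHom.mk' (fun r : R => i (r • m)) fun r s => by
        rw [add_smul, map_add]
      map_add' := fun m m' => CoDual.ext fun r => by
        change i (r • (m + m')) = i (r • m) + i (r • m')
        rw [smul_add, map_add]
      map_smul' := fun s m => CoDual.ext fun r => by
        change i (r • s • m) = i ((r * s) • m)
        rw [mul_smul] }
  refine ⟨T, f, (injective_iff_map_eq_zero f).2 fun m hm => hi ?_⟩
  have : i ((1 : R) • m) = 0 := DFunLike.congr_fun hm (1 : R)
  rwa [one_smul, ← map_zero i] at this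

end Resolution

/-! ### Syzygies and their pullbacks. -/

section Syzygy

variable {R : Type u} [Ring R]

/-- `G` is a `j`-th syzygy of `C`. -/
inductive IsSyzygy : ℕ → ModuleCat.{u} R → ModuleCat.{u} R → Prop
  | zero (C : ModuleCat.{u} R) : IsSyzygy 0 C C
  | succ {j : ℕ} {G V Y C : ModuleCat.{u} R} (f : G →ₗ[R] V) (g : V →ₗ[R] Y)
      (hV : Module.Projective R V) (hs : IsShortExact f g) (h : IsSyzygy j Y C) :
      IsSyzygy (j + 1) G C

/-- Each step back along a projective gains one term of the coresolution and improves `k + 1` to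
`k`, so nothing is required of `C`. -/
theorem IsSyzygy.hasG [IsNoetherianRing R] {n k j : ℕ} (hR : HasG R n k R) {G C : ModuleCat.{u} R}
    (h : IsSyzygy j G C) (hj : j ≤ n) : HasG R j k G := by
  induction h with
  | zero => trivial
  | @succ j G V Y C f g hV hs h ih =>
    exact HasG.of_isShortExact hs ((HasG.of_projective hR V).mono hj le_rfl)
      ((ih (by lia)).mono le_rfl (Nat.le_succ k))

/-- The pullback of two homomorphisms of modules. -/
abbrev pullback {X Y Z : Type u} [AddCommGroup X] [Module R X] [AddCommGroup Y] [Module R Y]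
    [AddCommGroup Z] [Module R Z] (φ : X →ₗ[R] Z) (π : Y →ₗ[R] Z) : Submodule R (X × Y) :=
  LinearMap.eqLocus (φ ∘ₗ LinearMap.fst R X Y) (π ∘ₗ LinearMap.snd R X Y)

/-- A syzygy of a submodule `C` of an injective module `Z 0` maps to the syzygy `Z j`, in such a way
that its pullback along `P j → Z j` is a syzygy of the quotient of `Z 0` by `C`. -/
theorem IsSyzygy.exists_pullback {n k j : ℕ} (T : BoundedResolution R n k)
    {G C C' : ModuleCat.{u} R} {f : C →ₗ[R] T.Z 0} {g : T.Z 0 →ₗ[R] C'} (hs : IsShortExact f g)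
    (h : IsSyzygy j G C) :
    ∃ φ : G →ₗ[R] T.Z j, IsSyzygy (j + 1) (ModuleCat.of R (pullback φ (T.π j))) C' := by
  induction h with
  | zero =>
    have hT := T.exact 0
    -- The pullback of `C → Z 0` along `P 0 → Z 0` is the kernel of `P 0 → Z 0 → C'`.
    refine ⟨f, IsSyzygy.succ (V := T.P 0) (LinearMap.snd R _ _ ∘ₗ (pullback f (T.π 0)).subtype)
      (g ∘ₗ T.π 0) (T.projective 0) ⟨?_, fun p => ⟨fun hp => ?_, ?_⟩, hs.2.2.comp hT.2.2⟩
      (IsSyzygy.zero C')⟩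
    · refine (injective_iff_map_eq_zero _).2 ?_
      rintro ⟨⟨c, p⟩, hcp : f c = T.π 0 p⟩ (hp : p = 0)
      subst hp
      have hc : c = 0 := hs.1 (by rw [hcp, map_zero, map_zero])
      subst hc
      rfl
    · obtain ⟨c, hc⟩ := (hs.2.1 _).1 hp
      exact ⟨⟨(c, p), hc⟩, rfl⟩
    · rintro ⟨⟨⟨c, p⟩, hcp : f c = T.π 0 p⟩, rfl⟩
      change g (T.π 0 p) = 0
      rw [← hcp]
      exact hs.2.1.apply_apply_eq_zero _
  | @succ j G V Y C i q hV hiq h ih =>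
    obtain ⟨φ, hφ⟩ := ih hs
    have hT := T.exact j
    obtain ⟨ψ, hψ⟩ := Module.projective_lifting_property (T.π j) (φ ∘ₗ q) hT.2.2
    have hψ' : ∀ v, T.π j (ψ v) = φ (q v) := DFunLike.congr_fun hψ
    obtain ⟨φ', hφ'⟩ := exists_lift hT.1 (ψ ∘ₗ i) fun x => (hT.2.1 _).1 (by
      rw [LinearMap.comp_apply, hψ', hiq.2.1.apply_apply_eq_zero, map_zero])
    let a : pullback φ' (T.π (j + 1)) →ₗ[R] V × T.P (j + 1) :=
      (LinearMap.prodMap i LinearMap.id) ∘ₗ (pullback φ' (T.π (j + 1))).subtype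
    -- Lifting `φ ∘ q` to `ψ : V → P j` induces `φ'` on `G`. The maps `a` and `b` present the new
    -- pullback as the kernel of `V × P (j+1)` mapping onto the old one.
    let b : V × T.P (j + 1) →ₗ[R] pullback φ (T.π j) := LinearMap.codRestrict _
      ((q ∘ₗ LinearMap.fst R _ _).prod
        (ψ ∘ₗ LinearMap.fst R _ _ - T.ι j ∘ₗ T.π (j + 1) ∘ₗ LinearMap.snd R _ _)) (by
        rintro ⟨v, p⟩
        change φ (q v) = T.π j (ψ v - T.ι j (T.π (j + 1) p))
        rw [map_sub, hT.2.1.apply_apply_eq_zero, sub_zero, hψ'])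
    have := T.projective (j + 1)
    refine ⟨φ', IsSyzygy.succ (V := ModuleCat.of R (V × T.P (j + 1)))
      (Y := ModuleCat.of R (pullback φ (T.π j))) a b inferInstance
      ⟨?_, fun v => ⟨fun hv => ?_, ?_⟩, ?_⟩ hφ⟩
    · exact (Function.Injective.prodMap hiq.1 Function.injective_id).comp Subtype.val_injective
    · obtain ⟨v, p⟩ := v
      have h1 : q v = 0 := congrArg (fun z => z.1.1) hv
      have h2 : ψ v - T.ι j (T.π (j + 1) p) = 0 := congrArg (fun z => z.1.2) hv
      obtain ⟨x, rfl⟩ := (hiq.2.1 v).1 h1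
      refine ⟨⟨(x, p), hT.1 ?_⟩, rfl⟩
      exact (hφ' x).trans (sub_eq_zero.1 h2)
    · rintro ⟨⟨⟨x, p⟩, hxp : φ' x = T.π (j + 1) p⟩, rfl⟩
      refine Subtype.ext (Prod.ext (hiq.2.1.apply_apply_eq_zero x) ?_)
      change ψ (i x) - T.ι j (T.π (j + 1) p) = 0
      rw [← hxp, hφ', LinearMap.comp_apply, sub_self]
    · rintro ⟨⟨y, p'⟩, hyp : φ y = T.π j p'⟩
      obtain ⟨v, rfl⟩ := hiq.2.2 y
      obtain ⟨z, hz⟩ := (hT.2.1 (ψ v - p')).1 (by rw [map_sub, hψ', hyp, sub_self])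
      obtain ⟨p, rfl⟩ := (T.exact (j + 1)).2.2 z
      refine ⟨(v, p), Subtype.ext (Prod.ext rfl ?_)⟩
      change ψ v - T.ι j (T.π (j + 1) p) = p'
      rw [hz, sub_sub_cancel]

end Syzygy

/-! ### The tower of syzygies over a module. -/

section Tower

variable {R : Type u} [Ring R]

/-- A surjection from an `i`-th syzygy to `M` with kernel of injective dimension at most `i + k`. -/
structure SyzygyCover (n k : ℕ) (M : Type u) [AddCommGroup M] [Module R M] (i : ℕ) where
  G : ModuleCat.{u} R
  C : ModuleCat.{u} R
  p : G →ₗ[R] M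
  surjective : Function.Surjective p
  isSyzygy : IsSyzygy i G C
  idLE : i ≤ n → IdLE R (i + k) (LinearMap.ker p)

variable [IsSemiprimaryRing R] [IsNoetherianRing Rᵐᵒᵖ] {n k : ℕ}

theorem SyzygyCover.exists_next (h : IsG Rᵐᵒᵖ n k R) {M : Type u} [AddCommGroup M] [Module R M]
    {i : ℕ} (s : SyzygyCover (R := R) n k M i) :
    ∃ (t : SyzygyCover (R := R) n k M (i + 1)) (β : t.G →ₗ[R] s.G),
      Function.Surjective β ∧ s.p ∘ₗ β = t.p := by
  obtain ⟨T, f, hf⟩ := exists_boundedResolution h s.C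
  obtain ⟨φ, hφ⟩ := IsSyzygy.exists_pullback T
    (C' := ModuleCat.of R (T.Z 0 ⧸ LinearMap.range f)) (isShortExact_mkQ hf) s.isSyzygy
  have hT := T.exact i
  let β : pullback φ (T.π i) →ₗ[R] s.G :=
    LinearMap.fst R _ _ ∘ₗ (pullback φ (T.π i)).subtype
  have hβ : Function.Surjective β := fun x => by
    obtain ⟨p, hp⟩ := hT.2.2 (φ x)
    exact ⟨⟨(x, p), hp.symm⟩, rfl⟩
  refine ⟨⟨ModuleCat.of R (pullback φ (T.π i)), _, s.p ∘ₗ β, s.surjective.comp hβ, hφ,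
    fun hi => ?_⟩, β, hβ, rfl⟩
  let a : T.Z (i + 1) →ₗ[R] LinearMap.ker (s.p ∘ₗ β) := LinearMap.codRestrict _
    (LinearMap.codRestrict (pullback φ (T.π i)) (LinearMap.inr R s.G (T.P i) ∘ₗ T.ι i) fun z => by
      change φ 0 = T.π i (T.ι i z)
      rw [map_zero, hT.2.1.apply_apply_eq_zero]) fun z => map_zero s.p
  let b : LinearMap.ker (s.p ∘ₗ β) →ₗ[R] LinearMap.ker s.p :=
    LinearMap.codRestrict _ (β ∘ₗ Submodule.subtype _) fun x => x.2
  -- The kernel of `β` is that of `P i → Z i`, namely `Z (i+1)`, so the new kernel is an extension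
  -- of the old one by `Z (i+1)`.
  have hab : IsShortExact (Y := LinearMap.ker (s.p ∘ₗ β)) (Z := LinearMap.ker s.p) a b := by
    refine ⟨fun z z' hz => hT.1 (congrArg (fun y => y.1.1.2) hz), fun x => ⟨fun hx => ?_, ?_⟩,
      fun y => ?_⟩
    · obtain ⟨⟨⟨x, p⟩, hxp : φ x = T.π i p⟩, hxk⟩ := x
      have h0 : x = 0 := congrArg Subtype.val hx
      subst h0
      obtain ⟨z, rfl⟩ := (hT.2.1 p).1 (by rw [← hxp, map_zero])
      exact ⟨z, rfl⟩
    · rintro ⟨z, rfl⟩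
      rfl
    · obtain ⟨x, hx⟩ := hβ y
      exact ⟨⟨x, (congrArg s.p hx).trans y.2⟩, Subtype.ext hx⟩
  exact hab.idLE_middle ((T.idLE_Z (i + 1) hi).mono (by lia))
    ((s.idLE (by lia)).mono (by lia))

/-- Every module `M` is the target of a tower of surjections from `G_j(k)`-modules whose kernels
have injective dimension at most `j + k`. -/
theorem exists_tower [IsNoetherianRing R] (hR : HasG R n k R) (h : IsG Rᵐᵒᵖ n k R)
    (M : Type u) [AddCommGroup M] [Module R M] :
    ∃ (G : ℕ → ModuleCat.{u} R) (p : ∀ j, G j →ₗ[R] M) (β : ∀ j, G (j + 1) →ₗ[R] G j), ∀ j,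
      Function.Surjective (p j) ∧
      (j ≤ n → IdLE R (j + k) (LinearMap.ker (p j)) ∧ IsG R j k (G j)) ∧
      Function.Surjective (β j) ∧ p j ∘ₗ β j = p (j + 1) := by
  choose next β hβ hp using
    fun (i : ℕ) (s : SyzygyCover (R := R) n k M i) => s.exists_next h
  let s₀ : SyzygyCover (R := R) n k M 0 :=
    { G := ModuleCat.of R M
      C := ModuleCat.of R M
      p := LinearMap.id
      surjective := Function.surjective_id
      isSyzygy := IsSyzygy.zero _
      idLE := fun _ => by
        refine IdLE.mono (d := 0) (idLE_zero_iff.2 ?_) (Nat.zero_le _)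
        rw [LinearMap.ker_id]
        exact ⟨fun _ _ _ _ _ _ _ _ _ => ⟨0, fun _ => Subsingleton.elim _ _⟩⟩ }
  let s : ∀ i, SyzygyCover (R := R) n k M i := fun i => Nat.rec s₀ next i
  exact ⟨fun j => (s j).G, fun j => (s j).p, fun j => β j (s j), fun j => ⟨(s j).surjective,
    fun hj => ⟨(s j).idLE hj, ((s j).isSyzygy.hasG hR hj).isG⟩, hβ j (s j), hp j (s j)⟩⟩

end Tower

end AuslanderType

/-! ### The two diagrams. -/

open AuslanderType CategoryTheory in
theorem theorem6p2 {A : Type*} [CommRing A] [IsArtinianRing A]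
    (R : Type u) [Ring R] [Algebra A R] [Module.Finite A R] (n k : ℕ)
    (hleft : IsG R n k R) (hright : IsG Rᵐᵒᵖ n k R)
    (M : Type u) [AddCommGroup M] [Module R M] :
    (∃ (I G : ℕ → ModuleCat.{u} R)
        (f : ∀ j, M →ₗ[R] I j) (g : ∀ j, I j →ₗ[R] G j)
        (α : ∀ j, I (j + 1) →ₗ[R] I j) (β : ∀ j, G (j + 1) →ₗ[R] G j),
      ∀ i, 1 ≤ i → i + 1 ≤ n →
        (∀ j, j = i ∨ j = i + 1 →
          IsShortExact (f j) (g j) ∧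
          HasInjectiveDimensionLE (I j) (j + k) ∧ IsG R j k (G j)) ∧
        Function.Surjective (α i) ∧ Function.Surjective (β i) ∧
        α i ∘ₗ f (i + 1) = f i ∧ β i ∘ₗ g (i + 1) = g i ∘ₗ α i) ∧
    (∃ (I G : ℕ → ModuleCat.{u} R)
        (f : ∀ j, I j →ₗ[R] G j) (g : ∀ j, G j →ₗ[R] M)
        (α : ∀ j, I (j + 1) →ₗ[R] I j) (β : ∀ j, G (j + 1) →ₗ[R] G j),
      ∀ i, 1 ≤ i → i + 1 ≤ n →
        (∀ j, j = i ∨ j = i + 1 →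
          IsShortExact (f j) (g j) ∧
          HasInjectiveDimensionLE (I j) (j + k) ∧ IsG R j k (G j)) ∧
        Function.Surjective (α i) ∧ Function.Surjective (β i) ∧
        β i ∘ₗ f (i + 1) = f i ∘ₗ α i ∧ g i ∘ₗ β i = g (i + 1)) := by
  -- Being finite over `A`, both `R` and `Rᵐᵒᵖ` are artinian, which supplies the noetherian and
  -- semiprimary conditions.
  have : IsArtinian A R := inferInstance
  have : IsArtinianRing R := isArtinian_of_tower A this
  have : Module.Finite A Rᵐᵒᵖ := Module.Finite.equiv (MulOpposite.opLinearEquiv A)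
  have : IsArtinian A Rᵐᵒᵖ := inferInstance
  have : IsArtinianRing Rᵐᵒᵖ := isArtinian_of_tower A this
  have hR : HasG R n k R := hleft.hasG
  constructor
  · obtain ⟨E, f₀, hE, hf₀⟩ := exists_injective_embedding (S := R) M
    -- `I_j` is the pullback of `E → E / M` and `G_j → E / M`: it contains `M` with quotient `G_j`,
    -- and `ker (p j)` with quotient `E`. The latter bounds its injective dimension.
    obtain ⟨G, p, β, h⟩ := exists_tower hR hright (E ⧸ LinearMap.range f₀)
    let q : E →ₗ[R] E ⧸ LinearMap.range f₀ := (LinearMap.range f₀).mkQ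
    have hq : IsShortExact f₀ q := isShortExact_mkQ hf₀
    have hp : ∀ j x, p j (β j x) = p (j + 1) x := fun j => DFunLike.congr_fun (h j).2.2.2
    let f : ∀ j, M →ₗ[R] pullback q (p j) := fun j => LinearMap.codRestrict _
      (LinearMap.inl R E (G j) ∘ₗ f₀) fun m =>
        (hq.2.1.apply_apply_eq_zero m).trans (map_zero (p j)).symm
    let g : ∀ j, pullback q (p j) →ₗ[R] G j := fun j =>
      LinearMap.snd R _ _ ∘ₗ Submodule.subtype _
    let α : ∀ j, pullback q (p (j + 1)) →ₗ[R] pullback q (p j) := fun j =>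
      LinearMap.codRestrict _ (LinearMap.prodMap LinearMap.id (β j) ∘ₗ Submodule.subtype _)
        fun x => (show q x.1.1 = p (j + 1) x.1.2 from x.2).trans (hp j _).symm
    have hfg : ∀ j, IsShortExact (f j) (g j) := fun j => by
      refine ⟨fun m m' hm => hf₀ (congrArg (fun y => y.1.1) hm), fun x => ⟨fun hx => ?_, ?_⟩,
        fun y => ?_⟩
      · obtain ⟨⟨e, y⟩, hey : q e = p j y⟩ := x
        have hy : y = 0 := hx
        subst hy
        obtain ⟨m, rfl⟩ := (hq.2.1 e).1 (hey.trans (map_zero _))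
        exact ⟨m, rfl⟩
      · rintro ⟨m, rfl⟩
        rfl
      · obtain ⟨e, he⟩ := hq.2.2 (p j y)
        exact ⟨⟨(e, y), he⟩, rfl⟩
    have hI : ∀ j ≤ n, IdLE R (j + k) (pullback q (p j)) := fun j hj => by
      let a : LinearMap.ker (p j) →ₗ[R] pullback q (p j) := LinearMap.codRestrict _
        (LinearMap.inr R E (G j) ∘ₗ Submodule.subtype _) fun x =>
          (map_zero q).trans (show p j x = 0 from x.2).symm
      let b : pullback q (p j) →ₗ[R] E := LinearMap.fst R _ _ ∘ₗ Submodule.subtype _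
      have hab : IsShortExact a b := by
        refine ⟨fun x y hxy => Subtype.ext (congrArg (fun y => y.1.2) hxy),
          fun x => ⟨fun hx => ?_, ?_⟩, fun e => ?_⟩
        · obtain ⟨⟨e, y⟩, hey : q e = p j y⟩ := x
          have he : e = 0 := hx
          subst he
          exact ⟨⟨y, hey.symm.trans (map_zero q)⟩, rfl⟩
        · rintro ⟨m, rfl⟩
          rfl
        · obtain ⟨y, hy⟩ := (h j).1 (q e)
          exact ⟨⟨(e, y), hy.symm⟩, rfl⟩
      exact hab.idLE_middle ((h j).2.1 hj).1 ((idLE_zero_iff.2 hE).mono (Nat.zero_le _))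
    refine ⟨fun j => ModuleCat.of R (pullback q (p j)), G, f, g, α, β, fun i _ hi =>
      ⟨fun j hj => ⟨hfg j, hI j (by lia), ((h j).2.1 (by lia)).2⟩, ?_, (h i).2.2.1, ?_, rfl⟩⟩
    · rintro ⟨⟨e, y⟩, hey : q e = p i y⟩
      obtain ⟨x, rfl⟩ := (h i).2.2.1 y
      exact ⟨⟨(e, x), hey.trans (hp i x)⟩, rfl⟩
    · exact LinearMap.ext fun m => Subtype.ext (Prod.ext rfl (map_zero (β i)))
  · obtain ⟨G, p, β, h⟩ := exists_tower hR hright M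
    have hp : ∀ j x, p j (β j x) = p (j + 1) x := fun j => DFunLike.congr_fun (h j).2.2.2
    refine ⟨fun j => ModuleCat.of R (LinearMap.ker (p j)), G,
      fun j => (LinearMap.ker (p j)).subtype, p,
      fun j => LinearMap.codRestrict _ (β j ∘ₗ (LinearMap.ker (p (j + 1))).subtype)
        fun x => (hp j x).trans x.2, β, fun i _ hi =>
      ⟨fun j hj => ⟨isShortExact_ker (h j).1, (h j).2.1 (by lia)⟩, ?_, (h i).2.2.1, rfl,
        (h i).2.2.2⟩⟩
    -- Since `p i ∘ β i = p (i+1)`, any preimage under `β i` of an element of `ker (p i)` lies in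
    -- `ker (p (i+1))`.
    rintro ⟨y, hy : p i y = 0⟩
    obtain ⟨x, rfl⟩ := (h i).2.2.1 y
    exact ⟨⟨x, (hp i x).symm.trans hy⟩, rfl⟩
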